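/- **Notation.** $(a)_n=a(a+1)\cdots(a+n-1)$ is the Pochhammer symbol. For $\alpha,\beta,\kappa,\gamma_1,\gamma_2,x,y\in\mathbb C$ with $\mathrm{Re}\,\alpha,\mathrm{Re}\,\beta,\mathrm{Re}\,\kappa>0$ the bivariate Jacobi–Konhauser Mittag-Leffler (JKML) function is $$E^{(\gamma_1;\gamma_2)}_{\alpha,\beta,\kappa}(x,y)=\sum_{s=0}^\infty\sum_{r=0}^\infty\frac{(\gamma_1)_{r+s}(\gamma_2)_s\,x^s y^{\kappa r}}{r!\,s!\,\Gamma(\alpha+s)\Gamma(\beta+\kappa r)},$$ with principal powers of $y$. For $n\in\mathbb N_0$, $\kappa\in\{1,2,\dots\}$ and real $\alpha,\beta>-1$ the bivariate Jacobi–Konhauser polynomial is $${}_\kappa P_n^{(\alpha,\beta)}(x,y)=\frac{\Gamma(1+\alpha+n)}{n!}\sum_{s=0}^n\sum_{r=0}^{n-s}\frac{(-n)_{s+r}(1+\alpha+\beta+n)_s}{s!\,r!\,\Gamma(1+\alpha+s)\Gamma(\beta+1+\kappa r)}\Big(\frac{1-x}2\Big)^s y^{\kappa r}.$$ For $\rho>0$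 let $H_\rho$ be the Hankel contour that runs from $-\infty$ to $-\rho$ with $\arg u=-\pi$, then counterclockwise along $|u|=\rho$ with $\arg u$ from $-\pi$ to $\pi$, and back from $-\rho$ to $-\infty$ with $\arg u=\pi$; powers $u^z=e^{z(\log|u|+i\arg u)}$ on $H_\rho$ are taken with this argument, and $(y/w)^\kappa$ means $y^\kappa/w^\kappa$. **Theorem.** Let $\alpha,\beta,\kappa,\gamma_1,\gamma_2,x,y\in\mathbb C$ with $\mathrm{Re}\,\alpha,\mathrm{Re}\,\beta,\mathrm{Re}\,\kappa,\mathrm{Re}\,\gamma_2>0$. Call functions $R,S$ on $(0,\infty)$ with positive values *admissible* if for every $t>0$, $u\in H_{R(t)}$, $w\in H_{S(t)}$ $$\Big|\frac{y^\kappa}{w^\kappa}\Big|<1\quad\text{and}\quad\Big|\frac{t x w^\kappa}{u(w^\kappa-y^\kappa)}\Big|<1 .$$ 1. The double series of $E^{(\gamma_1;\gamma_2)}_{\alpha,\beta,\kappa}(x,y)$ converges absolutely if $|x|<1$ or if $-\gamma_1\in\mathbb N_0$. 2. Admissible $R,S$ exist. 3. If the double series converges absolutely at $(x,y)$, then for all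 admissible $R,S$ $$E^{(\gamma_1;\gamma_2)}_{\alpha,\beta,\kappa}(x,y)=\frac{-1}{4\pi^2\Gamma(\gamma_2)}\int_0^\infty\int_{H_{R(t)}}\int_{H_{S(t)}}t^{\gamma_2-1}u^{-\alpha}w^{-\beta}e^{u+w-t}\Big[1-\Big(\frac yw\Big)^\kappa-\frac{tx}u\Big]^{-\gamma_1}dw\,du\,dt,$$ where the bracket is raised to the principal power, the inner double integral converges absolutely for every $t>0$, and the resulting function of $t$ is absolutely integrable on $(0,\infty)$. **Corollary.** Let $n\in\mathbb N_0$, $\kappa\in\{1,2,\dots\}$, $\alpha,\beta>-1$ real with $1+\alpha+\beta+n>0$ (automatic for $n\ge1$), and $x,y\in\mathbb C$. Then for all functions $R,S$ on $(0,\infty)$ with positive values $${}_\kappa P_n^{(\alpha,\beta)}(x,y)=\frac{-\Gamma(1+\alpha+n)}{4\pi^2\,\Gamma(1+\alpha+\beta+n)\,n!}\int_0^\infty\int_{H_{R(t)}}\int_{H_{S(t)}}t^{\alpha+\beta+n}u^{-(1+\alpha)}w^{-(1+\beta)}e^{u+w-t}\Big[1-\Big(\frac yw\Big)^\kappa-\frac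 tu\Big(\frac{1-x}2\Big)\Big]^{n}dw\,du\,dt,$$ with the same convergence of the integrals. -/

import Mathlib

noncomputable section

namespace JKML

/-- The general term of the double series of the bivariate Jacobi Konhauser Mittag-Leffler
function; `(ascPochhammer ℂ n).eval a` is the Pochhammer symbol `(a)_n`. -/
def seriesTerm (α β κ γ₁ γ₂ x y : ℂ) (s r : ℕ) : ℂ :=
  (ascPochhammer ℂ (r + s)).eval γ₁ * (ascPochhammer ℂ s).eval γ₂ * x ^ s * y ^ (κ * (r : ℂ)) /
    ((r.factorial : ℂ) * (s.factorial : ℂ) * Complex.Gamma (α + s) * Complex.Gamma (β + κ * r))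

/-- Absolute convergence of the double series. -/
def SeriesConverges (α β κ γ₁ γ₂ x y : ℂ) : Prop :=
  Summable fun p : ℕ × ℕ => ‖seriesTerm α β κ γ₁ γ₂ x y p.1 p.2‖

/-- The bivariate Jacobi Konhauser Mittag-Leffler function. -/
def jkml (α β κ γ₁ γ₂ x y : ℂ) : ℂ :=
  ∑' s : ℕ, ∑' r : ℕ, seriesTerm α β κ γ₁ γ₂ x y s r

/-- The bivariate Jacobi Konhauser polynomial of degree index `n`. -/
def jkPoly (κ n : ℕ) (α β x y : ℂ) : ℂ :=
  Complex.Gamma (1 + α + n) / (n.factorial : ℂ) *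
    ∑ s ∈ Finset.range (n + 1), ∑ r ∈ Finset.range (n - s + 1),
      (ascPochhammer ℂ (s + r)).eval (-(n : ℂ)) * (ascPochhammer ℂ s).eval (1 + α + β + n) /
        ((s.factorial : ℂ) * (r.factorial : ℂ) * Complex.Gamma (1 + α + s) *
          Complex.Gamma (β + 1 + (κ : ℂ) * r)) * ((1 - x) / 2) ^ s * y ^ (κ * r)

/-- The Hankel contour of radius `ρ`, parametrized by `τ ∈ ℝ`, in the logarithmic coordinate:
`hankelLog ρ τ` is `log |u| + i arg u` at the point `u` of parameter `τ`.
For `τ < -π` the point runs from `-∞` to `-ρ` with `arg u = -π`, for `-π ≤ τ ≤ π` it runs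
counterclockwise along `|u| = ρ` with `arg u = τ`, for `τ > π` it returns from `-ρ` to `-∞`
with `arg u = π`. The power `u ^ z`, continuous along the contour, is `exp (z * hankelLog ρ τ)`. -/
def hankelLog (ρ τ : ℝ) : ℂ :=
  if τ < -Real.pi then (Real.log (ρ - Real.pi - τ) : ℂ) - Real.pi * Complex.I
  else if τ ≤ Real.pi then (Real.log ρ : ℂ) + τ * Complex.I
  else (Real.log (ρ - Real.pi + τ) : ℂ) + Real.pi * Complex.I

/-- The point `u` of parameter `τ` on the Hankel contour of radius `ρ`. -/
def hankelPt (ρ τ : ℝ) : ℂ := Complex.exp (hankelLog ρ τ)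

/-- The power `u ^ z` at the point of parameter `τ`, with `-π ≤ arg u ≤ π` as above. -/
def hankelPow (ρ τ : ℝ) (z : ℂ) : ℂ := Complex.exp (z * hankelLog ρ τ)

/-- The velocity `du/dτ` of the Hankel contour (away from the two corners `τ = ±π`). -/
def hankelVel (ρ τ : ℝ) : ℂ :=
  if τ < -Real.pi then 1
  else if τ ≤ Real.pi then Complex.I * hankelPt ρ τ
  else -1

/-- The conditions `|y^κ / w^κ| < 1` and `|t x w^κ / (u (w^κ - y^κ))| < 1` for every `t > 0`,
every `u` on the Hankel contour of radius `R t` and every `w` on that of radius `S t`. -/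
def AdmissibleRadii (κ x y : ℂ) (R S : ℝ → ℝ) : Prop :=
  ∀ t : ℝ, 0 < t → 0 < R t ∧ 0 < S t ∧ ∀ σ τ : ℝ,
    ‖y ^ κ / hankelPow (S t) τ κ‖ < 1 ∧
    ‖(t : ℂ) * x * hankelPow (S t) τ κ /
      (hankelPt (R t) σ * (hankelPow (S t) τ κ - y ^ κ))‖ < 1

/-- The integrand
`t^(γ₂-1) u^(-α) w^(-β) e^(u+w-t) [1 - (y/w)^κ - t x / u]^(-γ₁)` times `(du/dσ) (dw/dτ)`,
with `u`, `w` on the Hankel contours of radii `R`, `S` at the parameters `σ`, `τ`. -/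
def jkmlIntegrand (α β κ γ₁ γ₂ x y : ℂ) (R S t σ τ : ℝ) : ℂ :=
  (t : ℂ) ^ (γ₂ - 1) * hankelPow R σ (-α) * hankelPow S τ (-β) *
    Complex.exp (hankelPt R σ + hankelPt S τ - t) *
    (1 - y ^ κ / hankelPow S τ κ - t * x / hankelPt R σ) ^ (-γ₁) *
    (hankelVel R σ * hankelVel S τ)

/-- The integrand
`t^(α+β+n) u^(-(1+α)) w^(-(1+β)) e^(u+w-t) [1 - (y/w)^κ - (t/u) ((1-x)/2)]^n`
times `(du/dσ) (dw/dτ)`. -/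
def jkPolyIntegrand (κ n : ℕ) (α β x y : ℂ) (R S t σ τ : ℝ) : ℂ :=
  (t : ℂ) ^ (α + β + n) * hankelPow R σ (-(1 + α)) * hankelPow S τ (-(1 + β)) *
    Complex.exp (hankelPt R σ + hankelPt S τ - t) *
    (1 - (y / hankelPt S τ) ^ κ - t / hankelPt R σ * ((1 - x) / 2)) ^ n *
    (hankelVel R σ * hankelVel S τ)

end JKML

end

/-!
On a Hankel contour, `∫ u ^ (-z) e ^ u du = 2 π i / Γ z`. Expanding the bracket of the integrand by
the binomial series in `(y / w) ^ κ` and in `t x / u`, the two contour integrals therefore produce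
the factors `1 / Γ(α + s)` and `1 / Γ(β + κ r)`, while Euler's integral over `t` produces
`Γ(γ₂ + s) = (γ₂)_s Γ γ₂`. The expansion may be integrated termwise over the contours because for
admissible radii both quotients stay bounded away from `1` in modulus on the whole contours. For
`γ₁ = -n` the expansion is finite and the radii are arbitrary; this case is the statement on
polynomials.
-/

noncomputable section

namespace JKML

open Complex MeasureTheory Filter Topology Set
open scoped Real

/-! ### The binomial series -/

lemma mul_le_abs_mul_of_abs_le {a b c : ℝ} (h : |b| ≤ c) : a * b ≤ |a| * c := by
  refine (le_abs_self _).trans ?_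
  rw [abs_mul]
  gcongr

lemma Gamma_add_natCast {z : ℂ} (hz : 0 < z.re) (n : ℕ) :
    Gamma (z + n) = (ascPochhammer ℂ n).eval z * Gamma z := by
  rw [← Gamma_add_nat_div_Gamma_eq z, div_mul_cancel₀ _ (Gamma_ne_zero_of_re_pos hz)]
  rintro k rfl
  simp only [neg_re, natCast_re, Left.neg_pos_iff] at hz
  exact hz.not_ge k.cast_nonneg

lemma ascPochhammer_eval_add (a : ℂ) (m n : ℕ) :
    (ascPochhammer ℂ (m + n)).eval a =
      (ascPochhammer ℂ m).eval a * (ascPochhammer ℂ n).eval (a + m) := by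
  simp [← ascPochhammer_mul]

lemma choose_add_natCast_sub_one (γ : ℂ) (n : ℕ) :
    Ring.choose (γ + n - 1) n = (ascPochhammer ℂ n).eval γ / (n.factorial : ℂ) := by
  have h := Ring.factorial_nsmul_multichoose_eq_ascPochhammer γ n
  rw [Polynomial.ascPochhammer_smeval_eq_eval] at h
  rw [eq_div_iff (by exact_mod_cast n.factorial_ne_zero), Ring.choose, ← h,
    show γ + n - 1 - n + 1 = γ by ring, nsmul_eq_mul, mul_comm]

lemma hasSum_one_sub_cpow (γ : ℂ) {z : ℂ} (hz : ‖z‖ < 1) :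
    HasSum (fun n : ℕ => (ascPochhammer ℂ n).eval γ / (n.factorial : ℂ) * z ^ n)
      ((1 - z) ^ (-γ)) := by
  have hmem : z ∈ Metric.eball 0 1 := by
    rw [Metric.mem_eball, edist_zero_right, ← ofReal_norm]
    exact ENNReal.ofReal_lt_one.2 hz
  have h := (one_div_one_sub_cpow_hasFPowerSeriesOnBall_zero γ).hasSum hmem
  simpa only [FormalMultilinearSeries.ofScalars_apply_eq, choose_add_natCast_sub_one, zero_add,
    one_div, smul_eq_mul, ← cpow_neg] using h

lemma summable_norm_ascPochhammer_div_factorial (γ : ℂ) {q : ℝ} (h0 : 0 ≤ q) (h1 : q < 1) :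
    Summable fun n : ℕ => ‖(ascPochhammer ℂ n).eval γ / (n.factorial : ℂ)‖ * q ^ n := by
  have hq : ‖(q : ℂ)‖ = q := by rw [norm_real, Real.norm_of_nonneg h0]
  simpa only [norm_mul, norm_pow, hq] using
    (hasSum_one_sub_cpow γ (hq.trans_lt h1)).summable.norm

lemma norm_one_sub_cpow_le (γ : ℂ) {z : ℂ} {q : ℝ} (hz : ‖z‖ ≤ q) (hq : q < 1) :
    ‖(1 - z) ^ (-γ)‖ ≤ ∑' n : ℕ, ‖(ascPochhammer ℂ n).eval γ / (n.factorial : ℂ)‖ * q ^ n := by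
  have hs := summable_norm_ascPochhammer_div_factorial γ ((norm_nonneg z).trans hz) hq
  rw [← (hasSum_one_sub_cpow γ (hz.trans_lt hq)).tsum_eq]
  refine tsum_of_norm_bounded hs.hasSum fun n => ?_
  rw [norm_mul, norm_pow]
  gcongr

lemma choose_mul_pow_mul_pow_le {a b : ℝ} (ha : 0 ≤ a) (hb : 0 ≤ b) (r s : ℕ) :
    ((r + s).choose r : ℝ) * (a ^ r * b ^ s) ≤ (a + b) ^ (r + s) := by
  have hmem : (r, s) ∈ Finset.HasAntidiagonal.antidiagonal (r + s) :=
    Finset.HasAntidiagonal.mem_antidiagonal.2 rfl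
  rw [(Commute.all a b).add_pow']
  simpa only [nsmul_eq_mul] using Finset.single_le_sum
    (f := fun m : ℕ × ℕ => (r + s).choose m.1 • (a ^ m.1 * b ^ m.2)) (fun m _ => by positivity) hmem

lemma exists_norm_ascPochhammer_add_le (γ : ℂ) {a b : ℝ} (ha : 0 ≤ a) (hb : 0 ≤ b)
    (hab : a + b < 1) :
    ∃ M : ℝ, ∀ s r : ℕ, ‖(ascPochhammer ℂ (r + s)).eval γ‖ / (r.factorial * s.factorial) *
      b ^ s * a ^ r ≤ M := by
  have hs := summable_norm_ascPochhammer_div_factorial γ (add_nonneg ha hb) hab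
  refine ⟨_, fun s r => le_trans ?_ (hs.le_tsum (r + s) fun n _ => by positivity)⟩
  have hfact : ((r + s).choose r : ℝ) * (r.factorial * s.factorial) = (r + s).factorial := by
    rw [← mul_assoc, Nat.choose_symm_add]
    exact_mod_cast Nat.add_choose_mul_factorial_mul_factorial r s
  have hchoose : ((r + s).choose r : ℝ) ≠ 0 := by
    exact_mod_cast (Nat.choose_pos (Nat.le_add_right r s)).ne'
  calc ‖(ascPochhammer ℂ (r + s)).eval γ‖ / (r.factorial * s.factorial) * b ^ s * a ^ r
      = ‖(ascPochhammer ℂ (r + s)).eval γ / ((r + s).factorial : ℂ)‖ *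
          (((r + s).choose r : ℝ) * (a ^ r * b ^ s)) := by
        rw [norm_div, Complex.norm_natCast, ← hfact]
        field_simp
    _ ≤ _ := by
        gcongr
        exact choose_mul_pow_mul_pow_le ha hb r s

lemma one_sub_re_pos {z : ℂ} (hz : ‖z‖ < 1) : 0 < (1 - z).re := by
  simpa using (re_le_norm z).trans_lt hz

lemma one_sub_ne_zero_of_norm_lt_one {z : ℂ} (hz : ‖z‖ < 1) : 1 - z ≠ 0 := fun h => by
  simpa [h] using one_sub_re_pos hz

/- Both factors of `1 - a - b = (1 - a) (1 - b / (1 - a))` have positive real part, so their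
arguments add up without leaving `(-π, π]`. -/
lemma one_sub_sub_cpow (γ : ℂ) {a b : ℂ} (ha : ‖a‖ < 1) (hb : ‖b / (1 - a)‖ < 1) :
    (1 - a - b) ^ (-γ) = (1 - a) ^ (-γ) * (1 - b / (1 - a)) ^ (-γ) := by
  have ha0 := one_sub_ne_zero_of_norm_lt_one ha
  have hb0 := one_sub_ne_zero_of_norm_lt_one hb
  have harg := abs_lt.1 (abs_arg_lt_pi_div_two_iff.2 (Or.inl (one_sub_re_pos ha)))
  have harg' := abs_lt.1 (abs_arg_lt_pi_div_two_iff.2 (Or.inl (one_sub_re_pos hb)))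
  rw [show 1 - a - b = (1 - a) * (1 - b / (1 - a)) by field_simp,
    cpow_def_of_ne_zero (mul_ne_zero ha0 hb0), cpow_def_of_ne_zero ha0, cpow_def_of_ne_zero hb0,
    ← exp_add, log_mul ha0 hb0, add_mul]
  constructor <;> linarith

/-! ### Hankel contours -/

/-- The modulus of the point of parameter `τ` on the Hankel contour of radius `ρ`. -/
def hankelAbs (ρ τ : ℝ) : ℝ := ρ + max 0 (|τ| - π)

/-- The argument, in `[-π, π]`, of the point of parameter `τ` on a Hankel contour. -/
def hankelArg (τ : ℝ) : ℝ := max (-π) (min π τ)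

lemma le_hankelAbs (ρ τ : ℝ) : ρ ≤ hankelAbs ρ τ := by
  simp [hankelAbs]

lemma hankelAbs_pos {ρ : ℝ} (hρ : 0 < ρ) (τ : ℝ) : 0 < hankelAbs ρ τ :=
  hρ.trans_le (le_hankelAbs ρ τ)

lemma abs_hankelArg_le (τ : ℝ) : |hankelArg τ| ≤ π :=
  abs_le.2 ⟨le_max_left _ _, max_le (by linarith [Real.pi_pos]) (min_le_left _ _)⟩

lemma hankelLog_of_lt (ρ : ℝ) {τ : ℝ} (h : τ < -π) :
    hankelLog ρ τ = (Real.log (ρ - π - τ) : ℂ) - π * I := by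
  simp [hankelLog, h]

lemma hankelLog_of_mem (ρ : ℝ) {τ : ℝ} (h : τ ∈ Icc (-π) π) :
    hankelLog ρ τ = (Real.log ρ : ℂ) + τ * I := by
  simp [hankelLog, h.1.not_gt, h.2]

lemma hankelLog_of_gt (ρ : ℝ) {τ : ℝ} (h : π < τ) :
    hankelLog ρ τ = (Real.log (ρ - π + τ) : ℂ) + π * I := by
  simp [hankelLog, h.not_ge, (by linarith [Real.pi_pos] : ¬ τ < -π)]

lemma hankelLog_eq (ρ τ : ℝ) :
    hankelLog ρ τ = (Real.log (hankelAbs ρ τ) : ℂ) + hankelArg τ * I := by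
  have hpi := Real.pi_pos
  rcases lt_or_ge τ (-π) with h | h
  · rw [hankelLog_of_lt ρ h, hankelAbs, hankelArg, abs_of_neg (by linarith),
      max_eq_right (by linarith), min_eq_right (by linarith), max_eq_left h.le,
      show ρ + (-τ - π) = ρ - π - τ by ring]
    push_cast
    ring
  rcases le_or_gt τ π with h' | h'
  · rw [hankelLog_of_mem ρ ⟨h, h'⟩, hankelAbs, hankelArg,
      max_eq_left (by linarith [abs_le.2 ⟨h, h'⟩]), min_eq_right h', max_eq_right h, add_zero]
  · rw [hankelLog_of_gt ρ h', hankelAbs, hankelArg, abs_of_pos (by linarith),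
      max_eq_right (by linarith), min_eq_left h'.le, max_eq_right (by linarith),
      show ρ + (τ - π) = ρ - π + τ by ring]

lemma continuous_hankelLog {ρ : ℝ} (hρ : 0 < ρ) : Continuous (hankelLog ρ) := by
  have habs : Continuous (hankelAbs ρ) := by unfold hankelAbs; fun_prop
  have harg : Continuous hankelArg := by unfold hankelArg; fun_prop
  have hlog := habs.log fun τ => (hankelAbs_pos hρ τ).ne'
  rw [funext (hankelLog_eq ρ)]
  fun_prop

lemma continuous_hankelPow {ρ : ℝ} (hρ : 0 < ρ) (z : ℂ) :
    Continuous fun τ => hankelPow ρ τ z :=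
  (continuous_const.mul (continuous_hankelLog hρ)).cexp

lemma continuous_hankelPt {ρ : ℝ} (hρ : 0 < ρ) : Continuous (hankelPt ρ) :=
  (continuous_hankelLog hρ).cexp

lemma measurable_hankelVel {ρ : ℝ} (hρ : 0 < ρ) : Measurable (hankelVel ρ) :=
  Measurable.ite measurableSet_Iio measurable_const
    (Measurable.ite measurableSet_Iic
      (measurable_const.mul (continuous_hankelPt hρ).measurable) measurable_const)

lemma hankelPow_ne_zero (ρ τ : ℝ) (z : ℂ) : hankelPow ρ τ z ≠ 0 := exp_ne_zero _

lemma hankelPow_add (ρ τ : ℝ) (z w : ℂ) :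
    hankelPow ρ τ (z + w) = hankelPow ρ τ z * hankelPow ρ τ w := by
  rw [hankelPow, add_mul, exp_add, hankelPow, hankelPow]

lemma hankelPow_neg (ρ τ : ℝ) (z : ℂ) : hankelPow ρ τ (-z) = (hankelPow ρ τ z)⁻¹ := by
  rw [hankelPow, neg_mul, exp_neg, hankelPow]

lemma hankelPow_mul_natCast (ρ τ : ℝ) (z : ℂ) (n : ℕ) :
    hankelPow ρ τ (z * n) = hankelPow ρ τ z ^ n := by
  rw [hankelPow, hankelPow, ← exp_nat_mul, mul_comm z, mul_assoc]

lemma hankelPow_natCast (ρ τ : ℝ) (n : ℕ) : hankelPow ρ τ n = hankelPt ρ τ ^ n := by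
  rw [hankelPow, hankelPt, ← exp_nat_mul]

lemma norm_hankelPt {ρ : ℝ} (hρ : 0 < ρ) (τ : ℝ) : ‖hankelPt ρ τ‖ = hankelAbs ρ τ := by
  rw [hankelPt, norm_exp, hankelLog_eq]
  simp [Real.exp_log (hankelAbs_pos hρ τ)]

lemma norm_hankelPow (ρ τ : ℝ) (z : ℂ) :
    ‖hankelPow ρ τ z‖ = Real.exp (z.re * Real.log (hankelAbs ρ τ) - z.im * hankelArg τ) := by
  rw [hankelPow, norm_exp, hankelLog_eq]
  simp

lemma norm_hankelPow_neg_le {ρ : ℝ} (hρ : 0 < ρ) (τ : ℝ) {z : ℂ} (hz : 0 ≤ z.re) :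
    ‖hankelPow ρ τ (-z)‖ ≤ Real.exp (π * |z.im| - z.re * Real.log ρ) := by
  have hlog := mul_le_mul_of_nonneg_left (Real.log_le_log hρ (le_hankelAbs ρ τ)) hz
  have harg := mul_le_abs_mul_of_abs_le (a := z.im) (abs_hankelArg_le τ)
  rw [norm_hankelPow, Real.exp_le_exp, neg_re, neg_im]
  linarith

lemma hankelPt_of_lt {ρ : ℝ} (hρ : 0 < ρ) {τ : ℝ} (h : τ < -π) :
    hankelPt ρ τ = -((ρ - π - τ : ℝ) : ℂ) := by
  rw [hankelPt, hankelLog_of_lt ρ h, exp_sub, exp_pi_mul_I, ← ofReal_exp,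
    Real.exp_log (by linarith), div_neg, div_one]

lemma hankelPt_of_gt {ρ : ℝ} (hρ : 0 < ρ) {τ : ℝ} (h : π < τ) :
    hankelPt ρ τ = -((ρ - π + τ : ℝ) : ℂ) := by
  rw [hankelPt, hankelLog_of_gt ρ h, exp_add, exp_pi_mul_I, ← ofReal_exp,
    Real.exp_log (by linarith), mul_neg_one]

lemma hankelVel_of_lt (ρ : ℝ) {τ : ℝ} (h : τ < -π) : hankelVel ρ τ = 1 := by
  simp [hankelVel, h]

lemma hankelVel_of_mem (ρ : ℝ) {τ : ℝ} (h : τ ∈ Icc (-π) π) :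
    hankelVel ρ τ = I * hankelPt ρ τ := by
  simp [hankelVel, h.1.not_gt, h.2]

lemma hankelVel_of_gt (ρ : ℝ) {τ : ℝ} (h : π < τ) : hankelVel ρ τ = -1 := by
  simp [hankelVel, h.not_ge, (by linarith [Real.pi_pos] : ¬ τ < -π)]

lemma norm_exp_mul_hankelVel_le {ρ : ℝ} (hρ : 0 < ρ) (τ : ℝ) :
    ‖exp (hankelPt ρ τ) * hankelVel ρ τ‖ ≤ (1 + ρ) * Real.exp (ρ + π) * Real.exp (-|τ|) := by
  have hpi := Real.pi_pos
  rw [norm_mul, mul_assoc, ← Real.exp_add, norm_exp]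
  have ray (r : ℝ) (hr : r = ρ - π + |τ|) :
      Real.exp (-r) ≤ (1 + ρ) * Real.exp (ρ + π + -|τ|) := by
    have : Real.exp (-r) ≤ Real.exp (ρ + π + -|τ|) := Real.exp_le_exp.2 (by linarith)
    exact this.trans (le_mul_of_one_le_left (Real.exp_pos _).le (by linarith))
  rcases lt_or_ge τ (-π) with h | h
  · rw [hankelVel_of_lt ρ h, hankelPt_of_lt hρ h, norm_one, mul_one, neg_re, ofReal_re]
    exact ray _ (by rw [abs_of_neg (by linarith)]; ring)
  rcases le_or_gt τ π with h' | h'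
  · have hτ := abs_le.2 ⟨h, h'⟩
    have hnorm : ‖hankelPt ρ τ‖ = ρ := by
      rw [norm_hankelPt hρ, hankelAbs, max_eq_left (by linarith), add_zero]
    have hre := (re_le_norm (hankelPt ρ τ)).trans_eq hnorm
    rw [hankelVel_of_mem ρ ⟨h, h'⟩, norm_mul, norm_I, one_mul, hnorm, mul_comm]
    gcongr <;> linarith
  · rw [hankelVel_of_gt ρ h', hankelPt_of_gt hρ h', norm_neg, norm_one, mul_one, neg_re, ofReal_re]
    exact ray _ (by rw [abs_of_pos (by linarith)])

/-! ### Hankel's formula -/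

/-- The integrand `u ^ (-z) e ^ u du` of Hankel's formula for `1 / Γ z`, at the point `u` of
parameter `τ` on the contour of radius `ρ`. -/
def hankelKernel (ρ : ℝ) (z : ℂ) (τ : ℝ) : ℂ :=
  hankelPow ρ τ (-z) * (exp (hankelPt ρ τ) * hankelVel ρ τ)

lemma norm_hankelKernel_le {ρ : ℝ} (hρ : 0 < ρ) {z : ℂ} (hz : 0 ≤ z.re) (τ : ℝ) :
    ‖hankelKernel ρ z τ‖ ≤ Real.exp (π * |z.im| - z.re * Real.log ρ) *
      ((1 + ρ) * Real.exp (ρ + π) * Real.exp (-|τ|)) := by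
  rw [hankelKernel, norm_mul]
  gcongr
  · exact norm_hankelPow_neg_le hρ τ hz
  · exact norm_exp_mul_hankelVel_le hρ τ

lemma measurable_hankelKernel {ρ : ℝ} (hρ : 0 < ρ) (z : ℂ) : Measurable (hankelKernel ρ z) :=
  (continuous_hankelPow hρ (-z)).measurable.mul
    ((continuous_hankelPt hρ).measurable.cexp.mul (measurable_hankelVel hρ))

lemma hankelKernel_add_mul_natCast (ρ : ℝ) (z w : ℂ) (n : ℕ) (τ : ℝ) :
    hankelKernel ρ (z + w * n) τ = hankelKernel ρ z τ / hankelPow ρ τ w ^ n := by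
  rw [hankelKernel, hankelKernel, neg_add, hankelPow_add, hankelPow_neg _ _ (w * n),
    hankelPow_mul_natCast]
  ring

lemma integrable_exp_neg_abs : Integrable fun τ : ℝ => Real.exp (-|τ|) := by
  refine Integrable.of_integral_ne_zero ?_
  rw [integral_comp_abs (f := fun x => Real.exp (-x)), integral_exp_neg_Ioi_zero]
  norm_num

lemma integrable_abs_mul_exp_neg_abs : Integrable fun τ : ℝ => |τ| * Real.exp (-|τ|) := by
  have hΓ : ∫ x in Ioi (0 : ℝ), x * Real.exp (-x) = 1 := by
    have := Real.Gamma_eq_integral (s := 2) two_pos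
    norm_num [mul_comm] at this
    exact this.symm
  refine Integrable.of_integral_ne_zero ?_
  rw [integral_comp_abs (f := fun x => x * Real.exp (-x)), hΓ]
  norm_num

lemma integrable_hankelKernel {ρ : ℝ} (hρ : 0 < ρ) {z : ℂ} (hz : 0 ≤ z.re) :
    Integrable (hankelKernel ρ z) :=
  Integrable.mono' ((integrable_exp_neg_abs.const_mul _).const_mul _)
    (measurable_hankelKernel hρ z).aestronglyMeasurable
    (ae_of_all _ (norm_hankelKernel_le hρ hz))

/-- The function `r ↦ r ^ (-z) e ^ (-r)`, whose integral over `(0, ∞)` is `Γ(1 - z)`; up to a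
constant factor it is the Hankel integrand on the two rays of the contour. -/
def rayDensity (z : ℂ) (r : ℝ) : ℂ := (Real.exp (-r) : ℂ) * (r : ℂ) ^ (-z)

/-- The Hankel integrand `u ^ (-z) e ^ u du` in the logarithmic coordinate `ζ = log u`, in which
it is entire. -/
def arcDensity (z ζ : ℂ) : ℂ := exp ((1 - z) * ζ + exp ζ)

lemma integrableOn_rayDensity {z : ℂ} (hz : z.re < 1) : IntegrableOn (rayDensity z) (Ioi 0) := by
  have h := GammaIntegral_convergent (s := 1 - z) (by simpa using hz)
  rwa [sub_sub_cancel_left] at h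

lemma integral_rayDensity {z : ℂ} (hz : z.re < 1) :
    ∫ r in Ioi 0, rayDensity z r = Gamma (1 - z) := by
  rw [Gamma_eq_integral (by simpa using hz), GammaIntegral]
  simp only [rayDensity, sub_sub_cancel_left]

lemma continuousOn_rayDensity (z : ℂ) : ContinuousOn (rayDensity z) (Ioi 0) := by
  refine ContinuousOn.mul (by fun_prop) ?_
  exact continuous_ofReal.continuousOn.cpow_const fun r hr => ofReal_mem_slitPlane.2 hr

lemma rayDensity_of_pos (z : ℂ) {r : ℝ} (hr : 0 < r) :
    rayDensity z r = exp (-z * Real.log r) * exp (-r) := by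
  rw [rayDensity, cpow_def_of_ne_zero (ofReal_ne_zero.2 hr.ne'), ← ofReal_log hr.le, ofReal_exp,
    ofReal_neg, mul_comm, mul_comm (-z)]

lemma hankelKernel_of_lt {ρ : ℝ} (hρ : 0 < ρ) (z : ℂ) {τ : ℝ} (h : τ < -π) :
    hankelKernel ρ z τ = exp (z * (π * I)) * rayDensity z (ρ - π - τ) := by
  rw [hankelKernel, hankelPow, hankelPt_of_lt hρ h, hankelLog_of_lt ρ h, hankelVel_of_lt ρ h,
    rayDensity_of_pos z (by linarith), mul_sub, sub_eq_add_neg, exp_add]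
  ring_nf

lemma hankelKernel_of_gt {ρ : ℝ} (hρ : 0 < ρ) (z : ℂ) {τ : ℝ} (h : π < τ) :
    hankelKernel ρ z τ = -exp (-z * (π * I)) * rayDensity z (ρ - π + τ) := by
  rw [hankelKernel, hankelPow, hankelPt_of_gt hρ h, hankelLog_of_gt ρ h, hankelVel_of_gt ρ h,
    rayDensity_of_pos z (by linarith), mul_add, exp_add]
  ring

lemma hankelKernel_of_mem (ρ : ℝ) (z : ℂ) {τ : ℝ} (h : τ ∈ Icc (-π) π) :
    hankelKernel ρ z τ = I * arcDensity z (Real.log ρ + τ * I) := by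
  rw [hankelKernel, hankelPow, hankelVel_of_mem ρ h, hankelPt, hankelLog_of_mem ρ h, arcDensity]
  generalize (Real.log ρ : ℂ) + τ * I = ζ
  rw [show (1 - z) * ζ + exp ζ = -z * ζ + ζ + exp ζ by ring, exp_add, exp_add]
  ring

lemma setIntegral_comp_const_add_Ioi {E : Type*} [NormedAddCommGroup E] [NormedSpace ℝ E]
    (f : ℝ → E) (a d : ℝ) : ∫ x in Ioi a, f (d + x) = ∫ x in Ioi (d + a), f x := by
  rw [← integral_indicator measurableSet_Ioi, ← integral_indicator measurableSet_Ioi,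
    ← integral_add_left_eq_self ((Ioi (d + a)).indicator f) d]
  simp [indicator, mem_Ioi]

lemma setIntegral_comp_const_sub_Iio {E : Type*} [NormedAddCommGroup E] [NormedSpace ℝ E]
    (f : ℝ → E) (a d : ℝ) : ∫ x in Iio a, f (d - x) = ∫ x in Ioi (d - a), f x := by
  rw [← integral_indicator measurableSet_Iio, ← integral_indicator measurableSet_Ioi,
    ← integral_sub_left_eq_self ((Ioi (d - a)).indicator f) volume d]
  simp [indicator, mem_Ioi]

lemma exp_mul_pi_I_sub_exp_neg (z : ℂ) :
    exp (z * (π * I)) - exp (-z * (π * I)) = 2 * I * sin (π * z) := by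
  rw [sin, show z * (π * I) = π * z * I by ring, show -z * (π * I) = -(π * z) * I by ring]
  linear_combination (exp (π * z * I) - exp (-(π * z) * I)) * I_sq

lemma integral_hankelKernel_eq_rays_add_circle {ρ : ℝ} (hρ : 0 < ρ) {z : ℂ} (hz : 0 ≤ z.re) :
    ∫ τ, hankelKernel ρ z τ = 2 * I * sin (π * z) * (∫ r in Ioi ρ, rayDensity z r) +
      I * ∫ θ in (-π)..π, arcDensity z (Real.log ρ + θ * I) := by
  have hpi := Real.pi_pos
  have hi := integrable_hankelKernel hρ hz
  have hleft : ∫ τ in Iic (-π), hankelKernel ρ z τ =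
      exp (z * (π * I)) * ∫ r in Ioi ρ, rayDensity z r := by
    rw [integral_Iic_eq_integral_Iio,
      setIntegral_congr_fun measurableSet_Iio fun τ hτ => hankelKernel_of_lt hρ z hτ,
      integral_const_mul, setIntegral_comp_const_sub_Iio, sub_neg_eq_add, sub_add_cancel]
  have hright : ∫ τ in Ioi π, hankelKernel ρ z τ =
      -exp (-z * (π * I)) * ∫ r in Ioi ρ, rayDensity z r := by
    rw [setIntegral_congr_fun measurableSet_Ioi fun τ hτ => hankelKernel_of_gt hρ z hτ,
      integral_const_mul, setIntegral_comp_const_add_Ioi, sub_add_cancel]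
  have hcircle : ∫ τ in (-π)..π, hankelKernel ρ z τ =
      I * ∫ θ in (-π)..π, arcDensity z (Real.log ρ + θ * I) := by
    rw [← intervalIntegral.integral_const_mul]
    refine intervalIntegral.integral_congr fun τ hτ => hankelKernel_of_mem ρ z ?_
    rwa [uIcc_of_le (by linarith)] at hτ
  rw [← intervalIntegral.integral_Iic_add_Ioi (b := -π) hi.integrableOn hi.integrableOn,
    ← intervalIntegral.integral_interval_add_Ioi (a := -π) (b := π) hi.integrableOn
      hi.integrableOn, hleft, hright, hcircle, ← exp_mul_pi_I_sub_exp_neg]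
  ring

lemma arcDensity_add_of_exp_eq_neg_one (z : ℂ) {c : ℂ} (hc : exp c = -1) (x : ℝ) :
    arcDensity z (x + c) = -exp (-z * c) * Real.exp x • rayDensity z (Real.exp x) := by
  rw [arcDensity, rayDensity_of_pos z (Real.exp_pos x), Real.log_exp, exp_add (x : ℂ) c, hc,
    real_smul, ofReal_exp, show (1 - z) * (x + c) + exp x * -1 =
      c + (-z * c + (x + (-z * x + -exp x))) by ring, exp_add c, hc, exp_add, exp_add, exp_add]
  ring

lemma integral_exp_smul_rayDensity_exp (z : ℂ) {ε ρ : ℝ} (hε : 0 < ε) (hρ : 0 < ρ) :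
    ∫ x in (Real.log ε)..(Real.log ρ), Real.exp x • rayDensity z (Real.exp x) =
      ∫ r in ε..ρ, rayDensity z r := by
  have hsub := intervalIntegral.integral_deriv_smul_comp' (a := Real.log ε) (b := Real.log ρ)
    (g := rayDensity z) (fun x _ => Real.hasDerivAt_exp x) Real.continuous_exp.continuousOn
    ((continuousOn_rayDensity z).mono (image_subset_iff.2 fun x _ => Real.exp_pos x))
  rwa [Real.exp_log hε, Real.exp_log hρ] at hsub

/- Cauchy's theorem for the rectangle with vertices `log ε ± πi`, `log ρ ± πi`. -/
lemma integral_arcDensity_eq_add {ε ρ : ℝ} (hε : 0 < ε) (hρ : 0 < ρ) (z : ℂ) :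
    I * (∫ θ in (-π)..π, arcDensity z (Real.log ρ + θ * I)) =
      I * (∫ θ in (-π)..π, arcDensity z (Real.log ε + θ * I)) +
        2 * I * sin (π * z) * ∫ r in ε..ρ, rayDensity z r := by
  have hd : Differentiable ℂ (arcDensity z) := by
    unfold arcDensity
    fun_prop
  have hrect := integral_boundary_rect_eq_zero_of_differentiableOn (arcDensity z)
    ((Real.log ε : ℂ) + ((-π : ℝ) : ℂ) * I) ((Real.log ρ : ℂ) + (π : ℂ) * I) hd.differentiableOn
  simp only [add_re, add_im, ofReal_re, ofReal_im, re_ofReal_mul, im_ofReal_mul, I_re, I_im,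
    mul_zero, mul_one, add_zero, zero_add, smul_eq_mul] at hrect
  have hneg : exp (((-π : ℝ) : ℂ) * I) = -1 := by
    rw [ofReal_neg, neg_mul, exp_neg, exp_pi_mul_I, inv_neg_one]
  simp_rw [arcDensity_add_of_exp_eq_neg_one z hneg,
    arcDensity_add_of_exp_eq_neg_one z exp_pi_mul_I, intervalIntegral.integral_const_mul,
    integral_exp_smul_rayDensity_exp z hε hρ] at hrect
  rw [show -z * (((-π : ℝ) : ℂ) * I) = z * (π * I) by push_cast; ring] at hrect
  rw [← exp_mul_pi_I_sub_exp_neg]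
  linear_combination hrect

lemma norm_arcDensity_le {ε : ℝ} (hε : 0 < ε) (z : ℂ) {θ : ℝ} (hθ : |θ| ≤ π) :
    ‖arcDensity z (Real.log ε + θ * I)‖ ≤ ε ^ (1 - z.re) * Real.exp (|z.im| * π + ε) := by
  have him := mul_le_abs_mul_of_abs_le (a := z.im) hθ
  have hre : (exp (Real.log ε + θ * I)).re ≤ ε := by
    refine (re_le_norm _).trans_eq ?_
    simp [norm_exp, Real.exp_log hε]
  rw [arcDensity, norm_exp, Real.rpow_def_of_pos hε, ← Real.exp_add, Real.exp_le_exp]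
  simp only [add_re, mul_re, sub_re, one_re, ofReal_re, I_re, ofReal_im, I_im, sub_im, one_im,
    add_im, mul_im] at hre ⊢
  linarith

lemma tendsto_integral_arcDensity {z : ℂ} (hz : z.re < 1) :
    Tendsto (fun ε : ℝ => ∫ θ in (-π)..π, arcDensity z (Real.log ε + θ * I)) (𝓝[>] 0) (𝓝 0) := by
  have hbound : Tendsto (fun ε : ℝ => ε ^ (1 - z.re) * Real.exp (|z.im| * π + ε) * |π - -π|)
      (𝓝[>] 0) (𝓝 0) := by
    have hcont : ContinuousAt
        (fun ε : ℝ => ε ^ (1 - z.re) * Real.exp (|z.im| * π + ε) * |π - -π|) 0 := by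
      refine ContinuousAt.mul (ContinuousAt.mul ?_ (by fun_prop)) (by fun_prop)
      exact Real.continuousAt_rpow_const _ _ (Or.inr (by linarith))
    have := hcont.tendsto
    rw [Real.zero_rpow (by linarith), zero_mul, zero_mul] at this
    exact this.mono_left nhdsWithin_le_nhds
  refine squeeze_zero_norm' ?_ hbound
  filter_upwards [self_mem_nhdsWithin] with ε hε
  refine intervalIntegral.norm_integral_le_of_norm_le_const fun θ hθ => norm_arcDensity_le hε z ?_
  rw [uIoc_of_le (by linarith [Real.pi_pos])] at hθ
  exact abs_le.2 ⟨hθ.1.le, hθ.2⟩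

lemma integral_arcDensity {ρ : ℝ} (hρ : 0 < ρ) {z : ℂ} (hz : z.re < 1) :
    I * (∫ θ in (-π)..π, arcDensity z (Real.log ρ + θ * I)) =
      2 * I * sin (π * z) * ∫ r in (0 : ℝ)..ρ, rayDensity z r := by
  have hint : IntegrableOn (rayDensity z) (uIcc 0 ρ) := by
    rw [uIcc_of_le hρ.le, integrableOn_Icc_iff_integrableOn_Ioc]
    exact (integrableOn_rayDensity hz).mono_set Ioc_subset_Ioi_self
  have hray : Tendsto (fun ε : ℝ => ∫ r in ε..ρ, rayDensity z r) (𝓝[>] 0)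
      (𝓝 (∫ r in (0 : ℝ)..ρ, rayDensity z r)) := by
    have := intervalIntegral.continuousOn_primitive_interval_left hint 0 left_mem_uIcc
    rw [uIcc_of_le hρ.le] at this
    refine this.tendsto.mono_left ?_
    rw [← nhdsWithin_Ioc_eq_nhdsGT hρ]
    exact nhdsWithin_mono _ Ioc_subset_Icc_self
  have hlim := ((tendsto_integral_arcDensity hz).const_mul I).add
    (hray.const_mul (2 * I * sin (π * z)))
  rw [mul_zero, zero_add] at hlim
  refine tendsto_nhds_unique (tendsto_const_nhds.congr' ?_) hlim
  filter_upwards [self_mem_nhdsWithin] with ε hε using integral_arcDensity_eq_add hε hρ z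

lemma integral_hankelKernel_of_re_lt_one {ρ : ℝ} (hρ : 0 < ρ) {z : ℂ} (h0 : 0 < z.re)
    (h1 : z.re < 1) : ∫ τ, hankelKernel ρ z τ = 2 * π * I * (Gamma z)⁻¹ := by
  have hi := integrableOn_rayDensity h1
  have hΓ := Gamma_ne_zero_of_re_pos h0
  have hΓ' := Gamma_ne_zero_of_re_pos (s := 1 - z) (by simpa using h1)
  have hrefl := Gamma_mul_Gamma_one_sub z
  have hsin : sin (π * z) ≠ 0 := fun h => by
    rw [h, div_zero] at hrefl
    exact mul_ne_zero hΓ hΓ' hrefl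
  rw [eq_div_iff hsin] at hrefl
  rw [integral_hankelKernel_eq_rays_add_circle hρ h0.le, integral_arcDensity hρ h1, ← mul_add,
    add_comm, intervalIntegral.integral_interval_add_Ioi hi (hi.mono_set (Ioi_subset_Ioi hρ.le)),
    integral_rayDensity h1, eq_mul_inv_iff_mul_eq₀ hΓ]
  linear_combination 2 * I * hrefl

lemma norm_hankelLog_le {ρ : ℝ} (hρ : 0 < ρ) (τ : ℝ) :
    ‖hankelLog ρ τ‖ ≤ |τ| / ρ + (|Real.log ρ| + π) := by
  have hup : hankelAbs ρ τ / ρ ≤ 1 + |τ| / ρ := by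
    rw [div_le_iff₀ hρ, add_mul, one_mul, div_mul_cancel₀ _ hρ.ne', hankelAbs]
    gcongr
    exact max_le (abs_nonneg τ) (by linarith [Real.pi_pos])
  have hratio : Real.log (hankelAbs ρ τ) - Real.log ρ ≤ |τ| / ρ := by
    rw [← Real.log_div (hankelAbs_pos hρ τ).ne' hρ.ne']
    linarith [Real.log_le_sub_one_of_pos (div_pos (hankelAbs_pos hρ τ) hρ)]
  have hmono := Real.log_le_log hρ (le_hankelAbs ρ τ)
  have hlog : |Real.log (hankelAbs ρ τ)| ≤ |τ| / ρ + |Real.log ρ| :=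
    abs_le.2 ⟨by linarith [neg_abs_le (Real.log ρ), div_nonneg (abs_nonneg τ) hρ.le],
      by linarith [le_abs_self (Real.log ρ)]⟩
  rw [hankelLog_eq]
  refine (norm_add_le _ _).trans ?_
  rw [norm_mul, norm_I, mul_one, norm_real, norm_real, Real.norm_eq_abs, Real.norm_eq_abs]
  linarith [abs_hankelArg_le τ]

lemma differentiableOn_integral_hankelKernel {ρ : ℝ} (hρ : 0 < ρ) :
    DifferentiableOn ℂ (fun z => ∫ τ, hankelKernel ρ z τ) {z | 0 < z.re} := by
  intro z hz
  set growth : ℂ → ℝ := fun w => Real.exp (π * |w.im| - w.re * Real.log ρ)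
  have hgrowth : Continuous growth := by fun_prop
  have hnhds : {w : ℂ | 0 < w.re ∧ growth w < growth z + 1} ∈ 𝓝 z :=
    ((isOpen_lt continuous_const continuous_re).inter
      (isOpen_lt hgrowth continuous_const)).mem_nhds ⟨hz, lt_add_one (growth z)⟩
  refine (hasDerivAt_integral_of_dominated_loc_of_deriv_le (μ := volume)
    (F' := fun w τ => -hankelLog ρ τ * hankelKernel ρ w τ)
    (bound := fun τ => (growth z + 1) * ((1 + ρ) * Real.exp (ρ + π)) *
      (ρ⁻¹ * (|τ| * Real.exp (-|τ|)) + (|Real.log ρ| + π) * Real.exp (-|τ|)))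
    hnhds (Eventually.of_forall fun w => (measurable_hankelKernel hρ w).aestronglyMeasurable)
    (integrable_hankelKernel hρ (show 0 < z.re from hz).le) ?_ ?_ ?_
    ?_).2.differentiableAt.differentiableWithinAt
  · exact ((continuous_hankelLog hρ).measurable.neg.mul
      (measurable_hankelKernel hρ z)).aestronglyMeasurable
  · refine ae_of_all _ fun τ w hw => ?_
    calc ‖-hankelLog ρ τ * hankelKernel ρ w τ‖
        ≤ (|τ| / ρ + (|Real.log ρ| + π)) *
            ((growth z + 1) * ((1 + ρ) * Real.exp (ρ + π) * Real.exp (-|τ|))) := by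
          rw [norm_mul, norm_neg]
          gcongr
          · exact norm_hankelLog_le hρ τ
          · refine (norm_hankelKernel_le hρ hw.1.le τ).trans ?_
            gcongr
            exact hw.2.le
      _ = _ := by ring
  · exact ((integrable_abs_mul_exp_neg_abs.const_mul _).add
      (integrable_exp_neg_abs.const_mul _)).const_mul _
  · refine ae_of_all _ fun τ w _ => ?_
    unfold hankelKernel hankelPow
    refine (((hasDerivAt_neg w).mul_const (hankelLog ρ τ)).cexp.mul_const _).congr_deriv ?_
    ring

/- Hankel's formula: both sides are holomorphic on the half-plane, so that agreement on the strip
`Re z < 1` suffices. -/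
theorem integral_hankelKernel {ρ : ℝ} (hρ : 0 < ρ) {z : ℂ} (hz : 0 < z.re) :
    ∫ τ, hankelKernel ρ z τ = 2 * π * I * (Gamma z)⁻¹ := by
  have hopen : IsOpen {w : ℂ | 0 < w.re} := isOpen_lt continuous_const continuous_re
  have hstrip : ∀ᶠ w in 𝓝 (1 / 2 : ℂ), 0 < w.re ∧ w.re < 1 :=
    (continuous_re.continuousAt.eventually_const_lt (by norm_num)).and
      (continuous_re.continuousAt.eventually_lt_const (by norm_num))
  have hleft := (differentiableOn_integral_hankelKernel hρ).analyticOnNhd hopen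
  exact hleft.eqOn_of_preconnected_of_eventuallyEq
    ((differentiable_one_div_Gamma.const_mul (2 * π * I)).differentiableOn.analyticOnNhd hopen)
    (convex_halfSpace_re_gt 0).isPreconnected (z₀ := 1 / 2) (by norm_num)
    (hstrip.mono fun w hw => integral_hankelKernel_of_re_lt_one hρ hw.1 hw.2) hz

/-! ### Absolute convergence of the double series -/

lemma exists_norm_inv_Gamma_le {ρ : ℝ} (hρ : 0 < ρ) :
    ∃ K : ℝ, 0 ≤ K ∧ ∀ z : ℂ, 0 < z.re →
      ‖(Gamma z)⁻¹‖ ≤ K * Real.exp (π * |z.im| - z.re * Real.log ρ) := by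
  set M := ∫ τ : ℝ, (1 + ρ) * Real.exp (ρ + π) * Real.exp (-|τ|)
  have hM0 : 0 ≤ M := integral_nonneg fun τ => by positivity
  have hpi := Real.pi_pos
  refine ⟨M / (2 * π), div_nonneg hM0 (by positivity), fun z hz => ?_⟩
  have hle := norm_integral_le_of_norm_le
    ((integrable_exp_neg_abs.const_mul ((1 + ρ) * Real.exp (ρ + π))).const_mul
      (Real.exp (π * |z.im| - z.re * Real.log ρ)))
    (ae_of_all _ (norm_hankelKernel_le hρ hz.le))
  have htwo : ‖(2 * π * I : ℂ)‖ = 2 * π := by simp [abs_of_pos hpi]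
  rw [integral_hankelKernel hρ hz, integral_const_mul, norm_mul, htwo] at hle
  rw [div_mul_eq_mul_div, le_div_iff₀ (by positivity)]
  linarith

lemma exists_mul_exp_sub_mul_log_le_half {a : ℝ} (ha : 0 < a) (b c : ℝ) :
    ∃ S > 0, c * Real.exp (b - a * Real.log S) ≤ 1 / 2 := by
  have htop : Tendsto (fun S => a * Real.log S) atTop atTop :=
    Real.tendsto_log_atTop.const_mul_atTop ha
  have hlim : Tendsto (fun S => c * Real.exp (b - a * Real.log S)) atTop (𝓝 0) := by
    have := (Real.tendsto_exp_atBot.comp (tendsto_atBot_add_const_left _ b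
      (tendsto_neg_atTop_atBot.comp htop))).const_mul c
    simpa [Function.comp_def, sub_eq_add_neg] using this
  exact ((eventually_gt_atTop 0).and (hlim.eventually_le_const one_half_pos)).exists

lemma summable_pow_mul_norm_inv_Gamma {β κ : ℂ} (hβ : 0 < β.re) (hκ : 0 < κ.re) {c : ℝ}
    (hc : 0 ≤ c) : Summable fun r : ℕ => c ^ r * ‖(Gamma (β + κ * r))⁻¹‖ := by
  obtain ⟨S, hS, hhalf⟩ := exists_mul_exp_sub_mul_log_le_half hκ (π * |κ.im|) c
  obtain ⟨K, hK0, hK⟩ := exists_norm_inv_Gamma_le hS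
  set A := Real.exp (π * |β.im| - β.re * Real.log S)
  set q := Real.exp (π * |κ.im| - κ.re * Real.log S)
  have hGamma (r : ℕ) : ‖(Gamma (β + κ * r))⁻¹‖ ≤ K * (A * q ^ r) := by
    have hre : (β + κ * r).re = β.re + κ.re * r := by simp
    have him : |(β + κ * r).im| ≤ |β.im| + |κ.im| * r := by
      simpa [abs_mul] using abs_add_le β.im (κ.im * r)
    refine (hK _ (by rw [hre]; positivity)).trans ?_
    rw [← Real.exp_nat_mul, ← Real.exp_add, hre]
    gcongr
    linarith [mul_le_mul_of_nonneg_left him Real.pi_pos.le]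
  refine Summable.of_nonneg_of_le (fun r => by positivity) (fun r => ?_)
    (summable_geometric_two.mul_left (K * A))
  calc c ^ r * ‖(Gamma (β + κ * r))⁻¹‖ ≤ c ^ r * (K * (A * q ^ r)) := by
        gcongr
        exact hGamma r
    _ = K * A * (c * q) ^ r := by rw [mul_pow]; ring
    _ ≤ K * A * (1 / 2) ^ r := by gcongr

lemma summable_norm_ascPochhammer_mul_inv_Gamma {α : ℂ} (hα : 0 < α.re) (γ : ℂ) {q : ℝ}
    (h0 : 0 ≤ q) (h1 : q < 1) :
    Summable fun s : ℕ => ‖(ascPochhammer ℂ s).eval γ * (Gamma (α + s))⁻¹‖ * q ^ s := by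
  have hratio : Tendsto (fun s : ℕ => ‖(γ + s) / (α + s)‖ * q) atTop (𝓝 q) := by
    have := (tendsto_add_mul_div_add_mul_atTop_nhds γ α 1 one_ne_zero).norm.mul_const q
    simpa using this
  obtain ⟨p, hqp, hp⟩ := exists_between h1
  refine summable_of_ratio_norm_eventually_le hp ?_
  filter_upwards [hratio.eventually_le_const hqp] with s hs
  have hne : α + s ≠ 0 := fun h => by
    have : 0 < (α + s).re := by simpa using add_pos_of_pos_of_nonneg hα s.cast_nonneg
    simp [h] at this
  calc ‖‖(ascPochhammer ℂ (s + 1)).eval γ * (Gamma (α + (s + 1 : ℕ)))⁻¹‖ * q ^ (s + 1)‖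
      = ‖(γ + s) / (α + s)‖ * q *
          ‖‖(ascPochhammer ℂ s).eval γ * (Gamma (α + s))⁻¹‖ * q ^ s‖ := by
        rw [ascPochhammer_succ_eval, Nat.cast_succ, ← add_assoc, Gamma_add_one _ hne,
          Real.norm_of_nonneg (by positivity), Real.norm_of_nonneg (by positivity), pow_succ]
        simp only [norm_mul, norm_inv, norm_div, mul_inv]
        ring
    _ ≤ _ := by gcongr

/-- The coefficient of `c ^ s` that the `r`-th term of the binomial expansion contributes to the
double Hankel integral at `c = t x`. It is the general term of the double series without the factor
`(γ₂)_s x ^ s`, which is produced by the integration in `t`. -/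
def contourCoeff (α β κ γ y : ℂ) (s r : ℕ) : ℂ :=
  (ascPochhammer ℂ (r + s)).eval γ / ((r.factorial : ℂ) * (s.factorial : ℂ)) *
    ((Gamma (α + s))⁻¹ * ((y ^ κ) ^ r * (Gamma (β + κ * r))⁻¹))

lemma seriesTerm_eq_mul_contourCoeff (α β κ γ₁ γ₂ x y : ℂ) (s r : ℕ) :
    seriesTerm α β κ γ₁ γ₂ x y s r =
      (ascPochhammer ℂ s).eval γ₂ * x ^ s * contourCoeff α β κ γ₁ y s r := by
  rw [seriesTerm, contourCoeff, cpow_mul_nat, div_eq_mul_inv, div_eq_mul_inv, mul_inv, mul_inv]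
  ring

lemma seriesConverges_of_norm_lt_one {α β κ : ℂ} (γ₁ γ₂ : ℂ) {x : ℂ} (y : ℂ) (hα : 0 < α.re)
    (hβ : 0 < β.re) (hκ : 0 < κ.re) (hx : ‖x‖ < 1) : SeriesConverges α β κ γ₁ γ₂ x y := by
  obtain ⟨b, hxb, hb1⟩ := exists_between hx
  obtain ⟨a, ha0, hab⟩ := exists_between (sub_pos.2 hb1)
  have hb0 : 0 < b := (norm_nonneg x).trans_lt hxb
  obtain ⟨M, hM⟩ := exists_norm_ascPochhammer_add_le γ₁ ha0.le hb0.le (by linarith)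
  have hs := summable_norm_ascPochhammer_mul_inv_Gamma hα γ₂ (q := ‖x‖ / b) (by positivity)
    (by rwa [div_lt_one hb0])
  have hr := summable_pow_mul_norm_inv_Gamma hβ hκ (c := ‖y ^ κ‖ / a) (by positivity)
  refine Summable.of_nonneg_of_le (fun p => norm_nonneg _) (fun ⟨s, r⟩ => ?_)
    ((hs.mul_of_nonneg hr (fun s => by positivity) fun r => by positivity).mul_left M)
  calc ‖seriesTerm α β κ γ₁ γ₂ x y s r‖
      = (‖(ascPochhammer ℂ (r + s)).eval γ₁‖ / (r.factorial * s.factorial) * b ^ s * a ^ r) *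
          (‖(ascPochhammer ℂ s).eval γ₂ * (Gamma (α + s))⁻¹‖ * (‖x‖ / b) ^ s *
            ((‖y ^ κ‖ / a) ^ r * ‖(Gamma (β + κ * r))⁻¹‖)) := by
        rw [seriesTerm_eq_mul_contourCoeff, contourCoeff]
        simp only [norm_mul, norm_div, norm_pow, Complex.norm_natCast, div_pow]
        field_simp
    _ ≤ _ := by
        gcongr
        exact hM s r

lemma contourCoeff_neg_natCast_eq_zero (α β κ y : ℂ) {n s r : ℕ} (h : n < r + s) :
    contourCoeff α β κ (-n) y s r = 0 := by
  simp [contourCoeff, ascPochhammer_eval_neg_coe_nat_of_lt h]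

lemma seriesConverges_neg_natCast (α β κ γ₂ x y : ℂ) (n : ℕ) :
    SeriesConverges α β κ (-n) γ₂ x y := by
  refine summable_of_ne_finset_zero (s := Finset.range (n + 1) ×ˢ Finset.range (n + 1))
    fun ⟨s, r⟩ hp => ?_
  simp only [Finset.mem_product, Finset.mem_range] at hp
  rw [seriesTerm_eq_mul_contourCoeff, contourCoeff_neg_natCast_eq_zero _ _ _ _ (by omega),
    mul_zero, norm_zero]

/-! ### Admissible radii -/

lemma norm_div_hankelPow_le {S : ℝ} (hS : 0 < S) (τ : ℝ) {κ : ℂ} (hκ : 0 ≤ κ.re) (c : ℂ) :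
    ‖c / hankelPow S τ κ‖ ≤ ‖c‖ * Real.exp (π * |κ.im| - κ.re * Real.log S) := by
  rw [div_eq_mul_inv, ← hankelPow_neg, norm_mul]
  gcongr
  exact norm_hankelPow_neg_le hS τ hκ

lemma mul_hankelPow_div_eq (c y κ : ℂ) (R S σ τ : ℝ) :
    c * hankelPow S τ κ / (hankelPt R σ * (hankelPow S τ κ - y ^ κ)) =
      c / hankelPt R σ / (1 - y ^ κ / hankelPow S τ κ) := by
  rw [one_sub_div (hankelPow_ne_zero S τ κ), div_div_eq_mul_div, div_mul_eq_mul_div, div_div]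

lemma exists_admissibleRadii {κ : ℂ} (x y : ℂ) (hκ : 0 < κ.re) :
    ∃ R S : ℝ → ℝ, AdmissibleRadii κ x y R S := by
  obtain ⟨S, hS, hhalf⟩ := exists_mul_exp_sub_mul_log_le_half hκ (π * |κ.im|) ‖y ^ κ‖
  refine ⟨fun t => 2 * ‖(t : ℂ) * x‖ + 1, fun _ => S, fun t _ => ⟨by positivity, hS, fun σ τ => ?_⟩⟩
  have hw : ‖y ^ κ / hankelPow S τ κ‖ ≤ 1 / 2 := (norm_div_hankelPow_le hS τ hκ.le _).trans hhalf
  refine ⟨hw.trans_lt one_half_lt_one, ?_⟩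
  have hR : 0 < 2 * ‖(t : ℂ) * x‖ + 1 := by positivity
  have hden : 1 / 2 ≤ ‖1 - y ^ κ / hankelPow S τ κ‖ := by
    have := norm_sub_norm_le 1 (y ^ κ / hankelPow S τ κ)
    rw [norm_one] at this
    linarith
  have hu := le_hankelAbs (2 * ‖(t : ℂ) * x‖ + 1) σ
  have hu0 := hankelAbs_pos hR σ
  rw [mul_hankelPow_div_eq, norm_div, norm_div, norm_hankelPt hR, div_div,
    div_lt_one (by positivity)]
  linarith [mul_le_mul hu hden one_half_pos.le hu0.le]

lemma exists_uniform_lt {X : Type*} [TopologicalSpace X] {f : X → ℝ} {L c : ℝ}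
    (hf : Continuous f) (hL : Tendsto f (cocompact X) (𝓝 L)) (hLc : L < c) (h : ∀ x, f x < c) :
    ∃ q < c, ∀ x, f x ≤ q := by
  by_cases hx : ∃ x₀, L < f x₀
  · obtain ⟨x₀, hx₀⟩ := hx
    obtain ⟨x₁, hx₁⟩ := hf.exists_forall_ge' x₀ (hL.eventually_le_const hx₀)
    exact ⟨f x₁, h x₁, hx₁⟩
  · push Not at hx
    exact ⟨L, hLc, hx⟩

lemma continuous_div_hankelPow {S : ℝ} (hS : 0 < S) (κ c : ℂ) :
    Continuous fun τ => c / hankelPow S τ κ :=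
  continuous_const.div (continuous_hankelPow hS κ) fun τ => hankelPow_ne_zero S τ κ

lemma tendsto_hankelAbs_cocompact (S : ℝ) : Tendsto (hankelAbs S) (cocompact ℝ) atTop := by
  refine tendsto_atTop_mono (fun τ => ?_)
    (tendsto_atTop_add_const_left _ (S - π) (tendsto_norm_cocompact_atTop (E := ℝ)))
  rw [hankelAbs, Real.norm_eq_abs]
  linarith [le_max_right 0 (|τ| - π)]

lemma tendsto_div_hankelPow (S : ℝ) {κ : ℂ} (hκ : 0 < κ.re) (c : ℂ) :
    Tendsto (fun τ => c / hankelPow S τ κ) (cocompact ℝ) (𝓝 0) := by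
  have hlim : Tendsto (fun τ => ‖c‖ * (Real.exp (|κ.im| * π) *
      Real.exp (-(κ.re * Real.log (hankelAbs S τ))))) (cocompact ℝ) (𝓝 0) := by
    have := Real.tendsto_exp_neg_atTop_nhds_zero.comp
      ((Real.tendsto_log_atTop.comp (tendsto_hankelAbs_cocompact S)).const_mul_atTop hκ)
    simpa [Function.comp_def] using (this.const_mul (Real.exp (|κ.im| * π))).const_mul ‖c‖
  refine squeeze_zero_norm (fun τ => ?_) hlim
  rw [div_eq_mul_inv, ← hankelPow_neg, norm_mul, norm_hankelPow, ← Real.exp_add]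
  gcongr
  have harg := mul_le_abs_mul_of_abs_le (a := κ.im) (abs_hankelArg_le τ)
  rw [neg_re, neg_im]
  linarith

lemma exists_lt_intCast_mul {b : ℝ} (hb : b ≠ 0) (a : ℝ) : ∃ k : ℤ, a < k * b := by
  obtain ⟨n, hn⟩ := Archimedean.arch (|a| + 1) (abs_pos.2 hb)
  have ha : a < n * |b| := by linarith [le_abs_self a, nsmul_eq_mul n |b|]
  rcases abs_choice b with h | h
  · exact ⟨n, by simpa [h] using ha⟩
  · exact ⟨-n, by simpa [h] using ha⟩

lemma div_hankelPow_eq_norm_of_im_eq (S τ : ℝ) {κ y : ℂ} (hy : y ≠ 0) (k : ℤ)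
    (h : (κ * (log y - hankelLog S τ)).im = k * (2 * π)) :
    y ^ κ / hankelPow S τ κ = (‖y ^ κ / hankelPow S τ κ‖ : ℂ) := by
  have hexp : y ^ κ / hankelPow S τ κ = exp (κ * (log y - hankelLog S τ)) := by
    rw [cpow_def_of_ne_zero hy, hankelPow, ← exp_sub, mul_comm (log y), mul_sub]
  rw [hexp, norm_exp, ofReal_exp, exp_eq_exp_iff_exists_int]
  refine ⟨k, ?_⟩
  conv_lhs => rw [← re_add_im (κ * (log y - hankelLog S τ)), h]
  push_cast
  ring

/- For real `κ` the point `arg w = arg y` works; otherwise `arg (w ^ κ)` is unbounded along the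
upper ray, where it depends affinely on `log |w|`. -/
lemma exists_div_hankelPow_eq_norm {S : ℝ} (hS : 0 < S) (κ : ℂ) {y : ℂ} (hy : y ≠ 0) :
    ∃ τ, y ^ κ / hankelPow S τ κ = (‖y ^ κ / hankelPow S τ κ‖ : ℂ) := by
  by_cases hκ : κ.im = 0
  · refine ⟨y.arg, div_hankelPow_eq_norm_of_im_eq S _ hy 0 ?_⟩
    rw [hankelLog_of_mem S ⟨(neg_pi_lt_arg y).le, arg_le_pi y⟩]
    simp [hκ, mul_im, log_im]
  set ℓ₀ := Real.log ‖y‖ + κ.re * (y.arg - π) / κ.im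
  obtain ⟨k, hk⟩ := exists_lt_intCast_mul (div_ne_zero Real.two_pi_pos.ne' hκ) (Real.log S - ℓ₀)
  set ℓ := ℓ₀ + k * (2 * π / κ.im) with hℓ
  have hS' : S < Real.exp ℓ := (Real.log_lt_iff_lt_exp hS).1 (by linarith)
  refine ⟨Real.exp ℓ - S + π, div_hankelPow_eq_norm_of_im_eq S _ hy (-k) ?_⟩
  rw [hankelLog_of_gt S (by linarith),
    show S - π + (Real.exp ℓ - S + π) = Real.exp ℓ by ring, Real.log_exp]
  simp only [mul_im, sub_im, sub_re, log_im, log_re, add_re, add_im, ofReal_re, ofReal_im, mul_re,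
    I_re, I_im, hℓ, ℓ₀, Int.cast_neg]
  field_simp
  ring

lemma exists_norm_one_sub_div_hankelPow_le {S : ℝ} (hS : 0 < S) {κ : ℂ} (hκ : κ ≠ 0) (y : ℂ)
    (h : ∀ τ, ‖y ^ κ / hankelPow S τ κ‖ < 1) : ∃ τ, ‖1 - y ^ κ / hankelPow S τ κ‖ ≤ 1 := by
  rcases eq_or_ne y 0 with rfl | hy
  · exact ⟨0, by simp [zero_cpow hκ]⟩
  obtain ⟨τ, hτ⟩ := exists_div_hankelPow_eq_norm hS κ hy
  refine ⟨τ, ?_⟩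
  rw [hτ, ← ofReal_one, ← ofReal_sub, norm_real, Real.norm_of_nonneg (by linarith [h τ])]
  linarith [norm_nonneg (y ^ κ / hankelPow S τ κ)]

lemma norm_hankelPt_zero {R : ℝ} (hR : 0 < R) : ‖hankelPt R 0‖ = R := by
  rw [norm_hankelPt hR, hankelAbs, max_eq_left (by simp [Real.pi_pos.le]), add_zero]

/- As `w → ∞` along the contour `y ^ κ / w ^ κ → 0`, so the only thing to exclude is that the
second quotient tends to `1` in modulus; a contour point at which `|1 - y ^ κ / w ^ κ| ≤ 1` does
this. -/
lemma exists_uniform_bound {κ c y : ℂ} {R S : ℝ} (hκ : 0 < κ.re) (hR : 0 < R) (hS : 0 < S)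
    (h : ∀ σ τ, ‖y ^ κ / hankelPow S τ κ‖ < 1 ∧
      ‖c / hankelPt R σ / (1 - y ^ κ / hankelPow S τ κ)‖ < 1) :
    ∃ q < 1, ∀ σ τ, ‖y ^ κ / hankelPow S τ κ‖ ≤ q ∧
      ‖c / hankelPt R σ / (1 - y ^ κ / hankelPow S τ κ)‖ ≤ q := by
  have hw (τ : ℝ) : ‖y ^ κ / hankelPow S τ κ‖ < 1 := (h 0 τ).1
  have hne (τ : ℝ) : 1 - y ^ κ / hankelPow S τ κ ≠ 0 := one_sub_ne_zero_of_norm_lt_one (hw τ)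
  have hκ0 : κ ≠ 0 := fun h0 => by simp [h0] at hκ
  have hA := continuous_div_hankelPow hS κ (y ^ κ)
  have hA0 := tendsto_div_hankelPow S hκ (y ^ κ)
  have hB (τ : ℝ) : ‖c‖ / R / ‖1 - y ^ κ / hankelPow S τ κ‖ < 1 := by
    simpa only [norm_div, norm_hankelPt_zero hR] using (h 0 τ).2
  have hlim : ‖c‖ / R < 1 := by
    obtain ⟨τ, hτ⟩ := exists_norm_one_sub_div_hankelPow_le hS hκ0 y hw
    exact ((div_lt_one (norm_pos_iff.2 (hne τ))).1 (hB τ)).trans_le hτ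
  have hB0 : Tendsto (fun τ => ‖c‖ / R / ‖1 - y ^ κ / hankelPow S τ κ‖) (cocompact ℝ)
      (𝓝 (‖c‖ / R)) := by
    simpa [Pi.div_def] using tendsto_const_nhds.div (hA0.const_sub 1).norm (by simp)
  obtain ⟨q₁, hq₁, h₁⟩ := exists_uniform_lt hA.norm (by simpa using hA0.norm) one_pos hw
  obtain ⟨q₂, hq₂, h₂⟩ := exists_uniform_lt
    (f := fun τ => ‖c‖ / R / ‖1 - y ^ κ / hankelPow S τ κ‖)
    (continuous_const.div (by fun_prop) fun τ => norm_ne_zero_iff.2 (hne τ)) hB0 hlim hB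
  refine ⟨max q₁ q₂, max_lt hq₁ hq₂, fun σ τ => ⟨(h₁ τ).trans (le_max_left _ _), ?_⟩⟩
  refine le_trans ?_ ((h₂ τ).trans (le_max_right _ _))
  rw [norm_div, norm_div, norm_hankelPt hR]
  gcongr
  exact le_hankelAbs R σ

/-! ### The double Hankel integral -/

lemma integrable_mul_one_sub_cpow {X : Type*} [MeasurableSpace X] {μ : Measure X} {k a : X → ℂ}
    {q : ℝ} (hk : Integrable k μ) (ha : AEMeasurable a μ) (hq : q < 1)
    (haq : ∀ᵐ x ∂μ, ‖a x‖ ≤ q) (γ : ℂ) : Integrable (fun x => k x * (1 - a x) ^ (-γ)) μ :=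
  hk.mul_bdd ((aemeasurable_const.sub ha).pow_const (-γ)).aestronglyMeasurable
    (haq.mono fun _ hx => norm_one_sub_cpow_le γ hx hq)

lemma hasSum_integral_mul_one_sub_cpow {X : Type*} [MeasurableSpace X] {μ : Measure X}
    {k a : X → ℂ} {q : ℝ} (hk : Integrable k μ) (ha : AEMeasurable a μ) (h0 : 0 ≤ q) (hq : q < 1)
    (haq : ∀ᵐ x ∂μ, ‖a x‖ ≤ q) (γ : ℂ) :
    HasSum (fun n : ℕ => (ascPochhammer ℂ n).eval γ / (n.factorial : ℂ) * ∫ x, k x * a x ^ n ∂μ)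
      (∫ x, k x * (1 - a x) ^ (-γ) ∂μ) := by
  have hs := summable_norm_ascPochhammer_div_factorial γ h0 hq
  simp only [← integral_const_mul]
  refine hasSum_integral_of_dominated_convergence
    (fun n x => ‖k x‖ * (‖(ascPochhammer ℂ n).eval γ / (n.factorial : ℂ)‖ * q ^ n))
    (fun n => ((hk.1.aemeasurable.mul (ha.pow_const n)).const_mul _).aestronglyMeasurable)
    (fun n => haq.mono fun x hx => ?_) (ae_of_all _ fun x => hs.mul_left _)
    (by simpa only [tsum_mul_left] using hk.norm.mul_const _) (haq.mono fun x hx => ?_)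
  · rw [mul_left_comm, norm_mul, norm_mul, norm_pow]
    gcongr
  · simpa only [mul_left_comm] using (hasSum_one_sub_cpow γ (hx.trans_lt hq)).mul_left (k x)

lemma re_add_mul_natCast_pos {z w : ℂ} (hz : 0 < z.re) (hw : 0 ≤ w.re) (n : ℕ) :
    0 < (z + w * n).re := by
  simp only [add_re, mul_re, natCast_re, natCast_im, mul_zero, sub_zero]
  positivity

lemma hankelKernel_mul_div_hankelPow_pow (ρ : ℝ) (z w c : ℂ) (n : ℕ) (τ : ℝ) :
    hankelKernel ρ z τ * (c / hankelPow ρ τ w) ^ n = c ^ n * hankelKernel ρ (z + w * n) τ := by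
  rw [hankelKernel_add_mul_natCast, div_pow]
  ring

lemma hankelPow_one (ρ τ : ℝ) : hankelPow ρ τ 1 = hankelPt ρ τ := by
  rw [hankelPow, hankelPt, one_mul]

section Monomial

variable {ρ : ℝ} {z : ℂ}

lemma integrable_hankelKernel_mul_div_hankelPow_pow (hρ : 0 < ρ) (hz : 0 < z.re) {w : ℂ}
    (hw : 0 ≤ w.re) (c : ℂ) (n : ℕ) :
    Integrable fun τ => hankelKernel ρ z τ * (c / hankelPow ρ τ w) ^ n := by
  simp only [hankelKernel_mul_div_hankelPow_pow]
  exact (integrable_hankelKernel hρ (re_add_mul_natCast_pos hz hw n).le).const_mul _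

lemma integral_hankelKernel_mul_div_hankelPow_pow (hρ : 0 < ρ) (hz : 0 < z.re) {w : ℂ}
    (hw : 0 ≤ w.re) (c : ℂ) (n : ℕ) :
    ∫ τ, hankelKernel ρ z τ * (c / hankelPow ρ τ w) ^ n =
      2 * π * I * (c ^ n * (Gamma (z + w * n))⁻¹) := by
  simp only [hankelKernel_mul_div_hankelPow_pow]
  rw [integral_const_mul, integral_hankelKernel hρ (re_add_mul_natCast_pos hz hw n)]
  ring

lemma integrable_hankelKernel_mul_div_hankelPt_pow (hρ : 0 < ρ) (hz : 0 < z.re) (c : ℂ) (n : ℕ) :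
    Integrable fun τ => hankelKernel ρ z τ * (c / hankelPt ρ τ) ^ n := by
  simpa only [hankelPow_one] using
    integrable_hankelKernel_mul_div_hankelPow_pow hρ hz (w := 1) (by simp) c n

lemma integral_hankelKernel_mul_div_hankelPt_pow (hρ : 0 < ρ) (hz : 0 < z.re) (c : ℂ) (n : ℕ) :
    ∫ τ, hankelKernel ρ z τ * (c / hankelPt ρ τ) ^ n =
      2 * π * I * (c ^ n * (Gamma (z + n))⁻¹) := by
  simpa only [hankelPow_one, one_mul] using
    integral_hankelKernel_mul_div_hankelPow_pow hρ hz (w := 1) (by simp) c n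

end Monomial

/-- The part of the integrand `jkmlIntegrand` that remains after removing `t ^ (γ₂ - 1) e ^ (-t)`,
as a function of the parameters of `u` and `w`; here `c` stands for `t x`. -/
def contourIntegrand (α β κ γ y c : ℂ) (R S : ℝ) (p : ℝ × ℝ) : ℂ :=
  hankelKernel R α p.1 * hankelKernel S β p.2 *
    (1 - y ^ κ / hankelPow S p.2 κ - c / hankelPt R p.1) ^ (-γ)

/-- The double Hankel integral converges absolutely and equals the power series in `c` obtained by
expanding the bracket and integrating term by term. -/
def HasContourExpansion (α β κ γ y c : ℂ) (R S : ℝ) : Prop :=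
  Integrable (contourIntegrand α β κ γ y c R S) ∧
    HasSum (fun s : ℕ => (2 * π * I) ^ 2 * (∑' r : ℕ, contourCoeff α β κ γ y s r) * c ^ s)
      (∫ p, contourIntegrand α β κ γ y c R S p)

section Binomial

variable {α β κ y c : ℂ} {R S : ℝ}

lemma tsum_contourCoeff_eq_integral {q : ℝ} (hα : 0 < α.re) (hβ : 0 < β.re) (hκ : 0 ≤ κ.re)
    (hR : 0 < R) (hS : 0 < S) (hq : q < 1) (h : ∀ τ, ‖y ^ κ / hankelPow S τ κ‖ ≤ q) (γ : ℂ)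
    (s : ℕ) :
    (2 * π * I) ^ 2 * (∑' r : ℕ, contourCoeff α β κ γ y s r) * c ^ s =
      (ascPochhammer ℂ s).eval γ / (s.factorial : ℂ) *
        ((∫ σ, hankelKernel R α σ * (c / hankelPt R σ) ^ s) *
          ∫ τ, hankelKernel S β τ * (1 - y ^ κ / hankelPow S τ κ) ^ (-(γ + s))) := by
  have hsum := hasSum_integral_mul_one_sub_cpow (integrable_hankelKernel hS hβ.le)
    (continuous_div_hankelPow hS κ (y ^ κ)).measurable.aemeasurable
    ((norm_nonneg _).trans (h 0)) hq (ae_of_all _ h) (γ + s)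
  rw [integral_hankelKernel_mul_div_hankelPt_pow hR hα, ← hsum.tsum_eq, ← tsum_mul_left,
    ← tsum_mul_left, ← tsum_mul_left, ← tsum_mul_right]
  refine tsum_congr fun r => ?_
  rw [integral_hankelKernel_mul_div_hankelPow_pow hS hβ hκ, contourCoeff, add_comm r s,
    ascPochhammer_eval_add]
  simp only [div_eq_mul_inv, mul_inv]
  ring

lemma div_pow_mul_one_sub_cpow {a : ℂ} (ha : 1 - a ≠ 0) (b γ : ℂ) (s : ℕ) :
    (1 - a) ^ (-γ) * (b / (1 - a)) ^ s = b ^ s * (1 - a) ^ (-(γ + s)) := by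
  rw [neg_add, cpow_add _ _ ha, cpow_neg _ (s : ℂ), cpow_natCast, div_pow]
  ring

/- With `a = y ^ κ / w ^ κ` and `b = c / u`, the power of the bracket is
`(1 - a) ^ (-γ) (1 - b / (1 - a)) ^ (-γ)`: expand the second factor in powers of `b / (1 - a)`;
each term is a product of a function of `u` and a function of `w`, and the latter is again a
binomial series. -/
theorem hasContourExpansion_of_norm_le {q : ℝ} (hα : 0 < α.re) (hβ : 0 < β.re) (hκ : 0 ≤ κ.re)
    (hR : 0 < R) (hS : 0 < S) (hq : q < 1)
    (h : ∀ σ τ, ‖y ^ κ / hankelPow S τ κ‖ ≤ q ∧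
      ‖c / hankelPt R σ / (1 - y ^ κ / hankelPow S τ κ)‖ ≤ q) (γ : ℂ) :
    HasContourExpansion α β κ γ y c R S := by
  set a : ℝ × ℝ → ℂ := fun p => y ^ κ / hankelPow S p.2 κ
  set b : ℝ × ℝ → ℂ := fun p => c / hankelPt R p.1
  set k : ℝ × ℝ → ℂ := fun p => hankelKernel R α p.1 * hankelKernel S β p.2
  have ha : Measurable a := (continuous_div_hankelPow hS κ (y ^ κ)).measurable.comp measurable_snd
  have hb : Measurable b := (continuous_hankelPt hR).measurable.const_div c |>.comp measurable_fst
  have haq (p : ℝ × ℝ) : ‖a p‖ ≤ q := (h p.1 p.2).1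
  have hbq (p : ℝ × ℝ) : ‖b p / (1 - a p)‖ ≤ q := (h p.1 p.2).2
  have hab : AEMeasurable (fun p => b p / (1 - a p)) :=
    (hb.div (measurable_const.sub ha)).aemeasurable
  have hk : Integrable fun p => k p * (1 - a p) ^ (-γ) :=
    integrable_mul_one_sub_cpow
      ((integrable_hankelKernel hR hα.le).mul_prod (integrable_hankelKernel hS hβ.le))
      ha.aemeasurable hq (ae_of_all _ haq) γ
  have hfactor : contourIntegrand α β κ γ y c R S =
      fun p => k p * (1 - a p) ^ (-γ) * (1 - b p / (1 - a p)) ^ (-γ) := by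
    funext p
    rw [contourIntegrand, one_sub_sub_cpow γ ((haq p).trans_lt hq) ((hbq p).trans_lt hq),
      ← mul_assoc]
  rw [HasContourExpansion, hfactor]
  refine ⟨integrable_mul_one_sub_cpow hk hab hq (ae_of_all _ hbq) γ,
    (hasSum_integral_mul_one_sub_cpow hk hab ((norm_nonneg _).trans (haq 0)) hq
      (ae_of_all _ hbq) γ).congr_fun fun s => ?_⟩
  rw [tsum_contourCoeff_eq_integral hα hβ hκ hR hS hq (fun τ => haq (0, τ)), ← integral_prod_mul,
    ← Measure.volume_eq_prod]
  congr 2 with p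
  rw [mul_assoc (k p), div_pow_mul_one_sub_cpow
    (one_sub_ne_zero_of_norm_lt_one ((haq p).trans_lt hq))]
  simp only [a, b, k]
  ring

theorem hasContourExpansion_of_admissibleRadii {x : ℂ} {R S : ℝ → ℝ} (hα : 0 < α.re)
    (hβ : 0 < β.re) (hκ : 0 < κ.re) (hRS : AdmissibleRadii κ x y R S) {t : ℝ} (ht : 0 < t)
    (γ : ℂ) : HasContourExpansion α β κ γ y (t * x) (R t) (S t) := by
  obtain ⟨hR, hS, h⟩ := hRS t ht
  simp only [mul_hankelPow_div_eq] at h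
  obtain ⟨q, hq, hle⟩ := exists_uniform_bound hκ hR hS h
  exact hasContourExpansion_of_norm_le hα hβ hκ.le hR hS hq hle γ

end Binomial

section Polynomial

lemma ascPochhammer_eval_neg_natCast_div_factorial (n m : ℕ) :
    (ascPochhammer ℂ m).eval (-(n : ℂ)) / (m.factorial : ℂ) = (-1) ^ m * (n.choose m : ℂ) := by
  rw [ascPochhammer_eval_neg_eq_descPochhammer, descPochhammer_eval_eq_descFactorial,
    Nat.descFactorial_eq_factorial_mul_choose, Nat.cast_mul]
  have hm : (m.factorial : ℂ) ≠ 0 := by exact_mod_cast m.factorial_ne_zero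
  field_simp

lemma one_sub_pow_eq_sum (n : ℕ) (z : ℂ) :
    (1 - z) ^ n = ∑ m ∈ Finset.range (n + 1),
      (ascPochhammer ℂ m).eval (-(n : ℂ)) / (m.factorial : ℂ) * z ^ m := by
  rw [show 1 - z = -z + 1 by ring, add_pow]
  refine Finset.sum_congr rfl fun m _ => ?_
  rw [ascPochhammer_eval_neg_natCast_div_factorial, neg_pow]
  ring

lemma one_sub_sub_pow_eq_sum (n : ℕ) (a b : ℂ) :
    (1 - a - b) ^ n = ∑ s ∈ Finset.range (n + 1), ∑ r ∈ Finset.range (n - s + 1),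
      (ascPochhammer ℂ (r + s)).eval (-(n : ℂ)) / ((r.factorial : ℂ) * (s.factorial : ℂ)) *
        (b ^ s * a ^ r) := by
  rw [show 1 - a - b = -b + (1 - a) by ring, add_pow]
  refine Finset.sum_congr rfl fun s hs => ?_
  have hsn : s ≤ n := Finset.mem_range_succ_iff.1 hs
  have hs0 : (s.factorial : ℂ) ≠ 0 := by exact_mod_cast s.factorial_ne_zero
  have hcoeff := (div_eq_iff hs0).1 (ascPochhammer_eval_neg_natCast_div_factorial n s)
  rw [one_sub_pow_eq_sum, Finset.mul_sum, Finset.sum_mul]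
  refine Finset.sum_congr rfl fun r _ => ?_
  rw [add_comm r s, ascPochhammer_eval_add, hcoeff, Nat.cast_sub hsn, neg_sub, sub_eq_neg_add,
    neg_pow b]
  field_simp

lemma tsum_contourCoeff_neg_natCast (α β κ y : ℂ) (n s : ℕ) :
    ∑' r, contourCoeff α β κ (-n) y s r =
      ∑ r ∈ Finset.range (n - s + 1), contourCoeff α β κ (-n) y s r :=
  tsum_eq_sum fun r hr => contourCoeff_neg_natCast_eq_zero _ _ _ _ <| by
    rw [Finset.mem_range] at hr
    omega

lemma tsum_contourCoeff_neg_natCast_eq_zero (α β κ y : ℂ) {n s : ℕ}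
    (hs : s ∉ Finset.range (n + 1)) : ∑' r, contourCoeff α β κ (-n) y s r = 0 := by
  rw [Finset.mem_range] at hs
  exact (tsum_congr fun r => contourCoeff_neg_natCast_eq_zero α β κ y (by omega)).trans tsum_zero

lemma contourIntegrand_neg_natCast (α β κ y c : ℂ) (n : ℕ) (R S : ℝ) (p : ℝ × ℝ) :
    contourIntegrand α β κ (-n) y c R S p =
      ∑ s ∈ Finset.range (n + 1), ∑ r ∈ Finset.range (n - s + 1),
        (ascPochhammer ℂ (r + s)).eval (-(n : ℂ)) / ((r.factorial : ℂ) * (s.factorial : ℂ)) *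
          (hankelKernel R α p.1 * (c / hankelPt R p.1) ^ s *
            (hankelKernel S β p.2 * (y ^ κ / hankelPow S p.2 κ) ^ r)) := by
  rw [contourIntegrand, neg_neg, cpow_natCast, one_sub_sub_pow_eq_sum, Finset.mul_sum]
  refine Finset.sum_congr rfl fun s _ => ?_
  rw [Finset.mul_sum]
  refine Finset.sum_congr rfl fun r _ => ?_
  ring

theorem hasContourExpansion_neg_natCast {α β κ : ℂ} {R S : ℝ} (hα : 0 < α.re) (hβ : 0 < β.re)
    (hκ : 0 ≤ κ.re) (hR : 0 < R) (hS : 0 < S) (y c : ℂ) (n : ℕ) :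
    HasContourExpansion α β κ (-n) y c R S := by
  have hint (s r : ℕ) (a : ℂ) : Integrable fun p : ℝ × ℝ =>
      a * (hankelKernel R α p.1 * (c / hankelPt R p.1) ^ s *
        (hankelKernel S β p.2 * (y ^ κ / hankelPow S p.2 κ) ^ r)) :=
    ((integrable_hankelKernel_mul_div_hankelPt_pow hR hα c s).mul_prod
      (integrable_hankelKernel_mul_div_hankelPow_pow hS hβ hκ (y ^ κ) r)).const_mul a
  have hvalue : ∫ p, contourIntegrand α β κ (-n) y c R S p = ∑ s ∈ Finset.range (n + 1),
      (2 * π * I) ^ 2 * (∑' r : ℕ, contourCoeff α β κ (-n) y s r) * c ^ s := by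
    simp only [contourIntegrand_neg_natCast]
    rw [integral_finsetSum _ fun s _ => integrable_finsetSum _ fun r _ => hint s r _]
    refine Finset.sum_congr rfl fun s _ => ?_
    rw [integral_finsetSum _ fun r _ => hint s r _, tsum_contourCoeff_neg_natCast, Finset.mul_sum,
      Finset.sum_mul]
    refine Finset.sum_congr rfl fun r _ => ?_
    rw [integral_const_mul, Measure.volume_eq_prod,
      integral_prod_mul (fun σ => hankelKernel R α σ * (c / hankelPt R σ) ^ s)
        fun τ => hankelKernel S β τ * (y ^ κ / hankelPow S τ κ) ^ r,
      integral_hankelKernel_mul_div_hankelPt_pow hR hα,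
      integral_hankelKernel_mul_div_hankelPow_pow hS hβ hκ, contourCoeff]
    ring
  refine ⟨?_, hvalue ▸ hasSum_sum_of_ne_finset_zero fun s hs => ?_⟩
  · rw [funext (contourIntegrand_neg_natCast α β κ y c n R S)]
    exact integrable_finsetSum _ fun s _ => integrable_finsetSum _ fun r _ => hint s r _
  · rw [tsum_contourCoeff_neg_natCast_eq_zero _ _ _ _ hs, mul_zero, zero_mul]

end Polynomial

/-! ### The integral over `t` -/

lemma integrable_tsum_of_summable_integral_norm {ι X E : Type*} [Countable ι] [MeasurableSpace X]
    {μ : Measure X} [NormedAddCommGroup E] {F : ι → X → E} (hF : ∀ i, Integrable (F i) μ)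
    (hsum : Summable fun i => ∫ a, ‖F i a‖ ∂μ) (hpt : ∀ᵐ a ∂μ, Summable fun i => F i a) :
    Integrable (fun a => ∑' i, F i a) μ := by
  refine ⟨aestronglyMeasurable_of_tendsto_ae atTop
    (f := fun (u : Finset ι) a => ∑ i ∈ u, F i a) (fun u =>
      Finset.aestronglyMeasurable_fun_sum u fun i _ => (hF i).1)
    (hpt.mono fun a ha => ha.hasSum), ?_⟩
  calc ∫⁻ a, ‖∑' i, F i a‖ₑ ∂μ ≤ ∫⁻ a, ∑' i, ‖F i a‖ₑ ∂μ :=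
        lintegral_mono fun a => enorm_tsum_le_tsum_enorm
    _ = ∑' i, ENNReal.ofReal (∫ a, ‖F i a‖ ∂μ) := by
        rw [lintegral_tsum fun i => (hF i).1.enorm]
        exact tsum_congr fun i => (ofReal_integral_norm_eq_lintegral_enorm (hF i)).symm
    _ < ⊤ := hsum.tsum_ofReal_lt_top

/-- The integrand `t ^ (z - 1) e ^ (-t)` of Euler's integral for `Γ z`. -/
def gammaDensity (z : ℂ) (t : ℝ) : ℂ := (t : ℂ) ^ (z - 1) * exp (-t)

lemma gammaDensity_eq (z : ℂ) :
    gammaDensity z = fun t : ℝ => ↑(Real.exp (-t)) * (t : ℂ) ^ (z - 1) := by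
  funext t
  rw [gammaDensity, ofReal_exp, ofReal_neg, mul_comm]

lemma integrableOn_gammaDensity {z : ℂ} (hz : 0 < z.re) :
    IntegrableOn (gammaDensity z) (Ioi 0) := by
  rw [gammaDensity_eq]
  exact GammaIntegral_convergent hz

lemma integral_gammaDensity {z : ℂ} (hz : 0 < z.re) :
    ∫ t in Ioi (0 : ℝ), gammaDensity z t = Gamma z := by
  rw [gammaDensity_eq, Gamma_eq_integral hz, GammaIntegral]

lemma integral_norm_gammaDensity {z : ℂ} (hz : 0 < z.re) :
    ∫ t in Ioi (0 : ℝ), ‖gammaDensity z t‖ = Real.Gamma z.re := by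
  rw [Real.Gamma_eq_integral hz]
  refine setIntegral_congr_fun measurableSet_Ioi fun t ht => ?_
  simp [gammaDensity, norm_cpow_eq_rpow_re_of_pos ht, norm_exp, mul_comm]

lemma gammaDensity_add_natCast {t : ℝ} (ht : 0 < t) (z : ℂ) (s : ℕ) :
    gammaDensity (z + s) t = gammaDensity z t * (t : ℂ) ^ s := by
  rw [gammaDensity, gammaDensity, add_sub_right_comm, cpow_add _ _ (by exact_mod_cast ht.ne'),
    cpow_natCast]
  ring

lemma Gamma_re_add_natCast_le {γ : ℂ} (hγ : 0 < γ.re) (s : ℕ) :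
    Real.Gamma (γ.re + s) ≤ Real.Gamma γ.re * ‖(ascPochhammer ℂ s).eval γ‖ := by
  induction s with
  | zero => simp
  | succ s ih =>
    have hpos : 0 < γ.re + s := by positivity
    have hle : γ.re + s ≤ ‖γ + s‖ := by simpa using re_le_norm (γ + s)
    rw [Nat.cast_succ, ← add_assoc, Real.Gamma_add_one hpos.ne', ascPochhammer_succ_eval, norm_mul,
      mul_comm, ← mul_assoc]
    exact mul_le_mul ih hle hpos.le ((Real.Gamma_pos_of_pos hpos).le.trans ih)

theorem integral_of_hasSum_gammaDensity {γ : ℂ} (hγ : 0 < γ.re) {c : ℕ → ℂ} {f : ℝ → ℂ}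
    (hc : Summable fun s : ℕ => ‖(ascPochhammer ℂ s).eval γ * c s‖)
    (hf : ∀ t : ℝ, 0 < t → HasSum (fun s : ℕ => gammaDensity (γ + s) t * c s) (f t)) :
    IntegrableOn f (Ioi 0) ∧
      ∫ t in Ioi (0 : ℝ), f t = Gamma γ * ∑' s, (ascPochhammer ℂ s).eval γ * c s := by
  have hre (s : ℕ) : 0 < (γ + s).re := by simpa using re_add_mul_natCast_pos hγ (w := 1) (by simp) s
  have hint (s : ℕ) : IntegrableOn (fun t => gammaDensity (γ + s) t * c s) (Ioi 0) :=
    (integrableOn_gammaDensity (hre s)).mul_const _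
  have hnorm : Summable fun s : ℕ => ∫ t in Ioi (0 : ℝ), ‖gammaDensity (γ + s) t * c s‖ := by
    refine Summable.of_nonneg_of_le (fun s => integral_nonneg fun t => norm_nonneg _) (fun s => ?_)
      (hc.mul_left (Real.Gamma γ.re))
    simp only [norm_mul]
    rw [integral_mul_const, integral_norm_gammaDensity (hre s), ← mul_assoc]
    gcongr
    simpa using Gamma_re_add_natCast_le hγ s
  have hfeq : EqOn (fun t => ∑' s : ℕ, gammaDensity (γ + s) t * c s) f (Ioi 0) :=
    fun t ht => (hf t ht).tsum_eq
  constructor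
  · exact IntegrableOn.congr_fun (integrable_tsum_of_summable_integral_norm hint hnorm
      ((ae_restrict_mem measurableSet_Ioi).mono fun t ht => (hf t ht).summable)) hfeq
      measurableSet_Ioi
  · rw [← setIntegral_congr_fun measurableSet_Ioi hfeq,
      ← integral_tsum_of_summable_integral_norm hint hnorm, ← tsum_mul_left]
    refine tsum_congr fun s => ?_
    rw [integral_mul_const, integral_gammaDensity (hre s), Gamma_add_natCast hγ]
    ring

lemma jkmlIntegrand_eq_gammaDensity_mul (α β κ γ₁ γ₂ x y : ℂ) (R S t σ τ : ℝ) :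
    jkmlIntegrand α β κ γ₁ γ₂ x y R S t σ τ =
      gammaDensity γ₂ t * contourIntegrand α β κ γ₁ y (t * x) R S (σ, τ) := by
  rw [jkmlIntegrand, gammaDensity, contourIntegrand, hankelKernel, hankelKernel,
    sub_eq_add_neg _ (t : ℂ), exp_add, exp_add]
  ring

lemma tsum_seriesTerm_eq (α β κ γ₁ γ₂ x y : ℂ) (s : ℕ) :
    ∑' r, seriesTerm α β κ γ₁ γ₂ x y s r =
      (ascPochhammer ℂ s).eval γ₂ * ((∑' r, contourCoeff α β κ γ₁ y s r) * x ^ s) := by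
  simp only [seriesTerm_eq_mul_contourCoeff, tsum_mul_left]
  ring

/-- The triple-integral representation of the JKML function, with the absolute convergence of the
inner double integral and of the outer integral. -/
def HasIntegralRepresentation (α β κ γ₁ γ₂ x y : ℂ) (R S : ℝ → ℝ) : Prop :=
  (∀ t : ℝ, 0 < t → Integrable (fun p : ℝ × ℝ =>
    jkmlIntegrand α β κ γ₁ γ₂ x y (R t) (S t) t p.1 p.2)) ∧
  IntegrableOn (fun t : ℝ => ∫ σ : ℝ, ∫ τ : ℝ,
    jkmlIntegrand α β κ γ₁ γ₂ x y (R t) (S t) t σ τ) (Ioi 0) ∧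
  jkml α β κ γ₁ γ₂ x y = -1 / (4 * (π : ℂ) ^ 2 * Gamma γ₂) *
    ∫ t in Ioi (0 : ℝ), ∫ σ : ℝ, ∫ τ : ℝ, jkmlIntegrand α β κ γ₁ γ₂ x y (R t) (S t) t σ τ

section Representation

variable {α β κ γ₁ γ₂ x y : ℂ}

lemma integrable_jkmlIntegrand {R S t : ℝ} (h : HasContourExpansion α β κ γ₁ y (t * x) R S) :
    Integrable fun p : ℝ × ℝ => jkmlIntegrand α β κ γ₁ γ₂ x y R S t p.1 p.2 := by
  simp only [jkmlIntegrand_eq_gammaDensity_mul]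
  exact h.1.const_mul _

lemma hasSum_integral_jkmlIntegrand {R S t : ℝ} (ht : 0 < t)
    (h : HasContourExpansion α β κ γ₁ y (t * x) R S) :
    HasSum (fun s : ℕ => gammaDensity (γ₂ + s) t *
        ((2 * π * I) ^ 2 * ((∑' r, contourCoeff α β κ γ₁ y s r) * x ^ s)))
      (∫ σ, ∫ τ, jkmlIntegrand α β κ γ₁ γ₂ x y R S t σ τ) := by
  have hiter := integral_prod _ h.1
  simp only [jkmlIntegrand_eq_gammaDensity_mul, integral_const_mul]
  rw [← hiter]
  refine (h.2.mul_left (gammaDensity γ₂ t)).congr_fun fun s => ?_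
  rw [gammaDensity_add_natCast ht, mul_pow]
  ring

theorem hasIntegralRepresentation_of_hasContourExpansion (hγ : 0 < γ₂.re) {R S : ℝ → ℝ}
    (hsum : Summable fun s => ∑' r, seriesTerm α β κ γ₁ γ₂ x y s r)
    (h : ∀ t : ℝ, 0 < t → HasContourExpansion α β κ γ₁ y (t * x) (R t) (S t)) :
    HasIntegralRepresentation α β κ γ₁ γ₂ x y R S := by
  have hc : Summable fun s => ‖(ascPochhammer ℂ s).eval γ₂ *
      ((2 * π * I) ^ 2 * ((∑' r, contourCoeff α β κ γ₁ y s r) * x ^ s))‖ := by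
    simpa only [tsum_seriesTerm_eq, norm_mul, mul_left_comm] using
      hsum.norm.mul_left ‖(2 * π * I : ℂ) ^ 2‖
  obtain ⟨hint, hvalue⟩ := integral_of_hasSum_gammaDensity hγ hc
    fun t ht => hasSum_integral_jkmlIntegrand (γ₂ := γ₂) ht (h t ht)
  refine ⟨fun t ht => integrable_jkmlIntegrand (h t ht), hint, ?_⟩
  have hpi : (π : ℂ) ≠ 0 := by exact_mod_cast Real.pi_ne_zero
  have hGamma := Gamma_ne_zero_of_re_pos hγ
  simp only [mul_left_comm _ ((2 * π * I : ℂ) ^ 2), tsum_mul_left, ← tsum_seriesTerm_eq] at hvalue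
  rw [hvalue, jkml, mul_pow, I_sq]
  field_simp
  ring

end Representation

lemma SeriesConverges.summable_tsum {α β κ γ₁ γ₂ x y : ℂ}
    (h : SeriesConverges α β κ γ₁ γ₂ x y) :
    Summable fun s => ∑' r, seriesTerm α β κ γ₁ γ₂ x y s r :=
  h.of_norm.prod

theorem hasIntegralRepresentation_neg_natCast {α β κ γ₂ : ℂ} (hα : 0 < α.re) (hβ : 0 < β.re)
    (hκ : 0 ≤ κ.re) (hγ : 0 < γ₂.re) (x y : ℂ) (n : ℕ) {R S : ℝ → ℝ}
    (hRS : ∀ t : ℝ, 0 < t → 0 < R t ∧ 0 < S t) :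
    HasIntegralRepresentation α β κ (-n) γ₂ x y R S :=
  hasIntegralRepresentation_of_hasContourExpansion hγ
    (seriesConverges_neg_natCast α β κ γ₂ x y n).summable_tsum fun t ht =>
      hasContourExpansion_neg_natCast hα hβ hκ (hRS t ht).1 (hRS t ht).2 y _ n

lemma jkPolyIntegrand_eq_jkmlIntegrand (κ n : ℕ) (α β x y : ℂ) (R S t σ τ : ℝ) :
    jkPolyIntegrand κ n α β x y R S t σ τ =
      jkmlIntegrand (1 + α) (1 + β) κ (-n) (1 + α + β + n) ((1 - x) / 2) y R S t σ τ := by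
  rw [jkPolyIntegrand, jkmlIntegrand, neg_neg, cpow_natCast, cpow_natCast, hankelPow_natCast,
    div_pow, div_mul_eq_mul_div, show 1 + α + β + n - 1 = α + β + n by ring]

lemma jkPoly_eq_jkml (κ n : ℕ) (α β x y : ℂ) :
    jkPoly κ n α β x y = Gamma (1 + α + n) / (n.factorial : ℂ) *
      jkml (1 + α) (1 + β) κ (-n) (1 + α + β + n) ((1 - x) / 2) y := by
  rw [jkPoly, jkml, tsum_eq_sum (s := Finset.range (n + 1)) fun s hs => by
    rw [tsum_seriesTerm_eq, tsum_contourCoeff_neg_natCast_eq_zero _ _ _ _ hs, zero_mul, mul_zero]]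
  congr 1
  refine Finset.sum_congr rfl fun s _ => ?_
  simp only [seriesTerm_eq_mul_contourCoeff, tsum_mul_left, tsum_contourCoeff_neg_natCast,
    Finset.mul_sum]
  refine Finset.sum_congr rfl fun r _ => ?_
  rw [contourCoeff, cpow_natCast, ← pow_mul, add_comm r s, add_comm β 1]
  simp only [div_eq_mul_inv, mul_inv]
  ring

end JKML

end

theorem mainTheorem8_general :
    (∀ α β κ γ₁ γ₂ x y : ℂ, 0 < α.re → 0 < β.re → 0 < κ.re → 0 < γ₂.re →
      ((‖x‖ < 1 ∨ ∃ n : ℕ, γ₁ = -(n : ℂ)) → JKML.SeriesConverges α β κ γ₁ γ₂ x y) ∧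
      (∃ R S : ℝ → ℝ, JKML.AdmissibleRadii κ x y R S) ∧
      ((Summable fun s : ℕ => ∑' r : ℕ, JKML.seriesTerm α β κ γ₁ γ₂ x y s r) →
        ∀ R S : ℝ → ℝ, JKML.AdmissibleRadii κ x y R S →
          JKML.HasIntegralRepresentation α β κ γ₁ γ₂ x y R S)) ∧
    (∀ (κ n : ℕ) (α β x y : ℂ), -1 < α.re → -1 < β.re → 0 < (1 + α + β + n).re →
      ∀ R S : ℝ → ℝ, (∀ t : ℝ, 0 < t → 0 < R t ∧ 0 < S t) →
        (∀ t : ℝ, 0 < t → MeasureTheory.Integrable (fun p : ℝ × ℝ =>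
          JKML.jkPolyIntegrand κ n α β x y (R t) (S t) t p.1 p.2)) ∧
        MeasureTheory.IntegrableOn (fun t : ℝ => ∫ σ : ℝ, ∫ τ : ℝ,
          JKML.jkPolyIntegrand κ n α β x y (R t) (S t) t σ τ) (Set.Ioi 0) ∧
        JKML.jkPoly κ n α β x y =
          -Complex.Gamma (1 + α + n) /
              (4 * (Real.pi : ℂ) ^ 2 * Complex.Gamma (1 + α + β + n) * (n.factorial : ℂ)) *
            ∫ t in Set.Ioi (0 : ℝ), ∫ σ : ℝ, ∫ τ : ℝ,
              JKML.jkPolyIntegrand κ n α β x y (R t) (S t) t σ τ) := by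
  refine ⟨fun α β κ γ₁ γ₂ x y hα hβ hκ hγ => ⟨?_, JKML.exists_admissibleRadii x y hκ,
    fun hs R S hRS => JKML.hasIntegralRepresentation_of_hasContourExpansion hγ hs fun t ht =>
      JKML.hasContourExpansion_of_admissibleRadii hα hβ hκ hRS ht γ₁⟩,
    fun κ n α β x y hα hβ hγ R S hRS => ?_⟩
  · rintro (hx | ⟨n, rfl⟩)
    · exact JKML.seriesConverges_of_norm_lt_one γ₁ γ₂ y hα hβ hκ hx
    · exact JKML.seriesConverges_neg_natCast α β κ γ₂ x y n
  · have hα' : 0 < (1 + α).re := neg_lt_iff_pos_add'.1 hα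
    have hβ' : 0 < (1 + β).re := neg_lt_iff_pos_add'.1 hβ
    obtain ⟨hinner, houter, hvalue⟩ := JKML.hasIntegralRepresentation_neg_natCast hα' hβ'
      (κ := κ) (by simp) hγ ((1 - x) / 2) y n hRS
    simp only [JKML.jkPolyIntegrand_eq_jkmlIntegrand, JKML.jkPoly_eq_jkml]
    refine ⟨hinner, houter, ?_⟩
    rw [hvalue, ← mul_assoc]
    congr 1
    simp only [div_eq_mul_inv, mul_inv]
    ring

theorem mainTheorem8 :
    (∀ α β κ γ₁ γ₂ x y : ℂ, 0 < α.re → 0 < β.re → 0 < κ.re → 0 < γ₂.re →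
      ((‖x‖ < 1 ∨ ∃ n : ℕ, γ₁ = -(n : ℂ)) → JKML.SeriesConverges α β κ γ₁ γ₂ x y) ∧
      (∃ R S : ℝ → ℝ, JKML.AdmissibleRadii κ x y R S) ∧
      (JKML.SeriesConverges α β κ γ₁ γ₂ x y →
        ∀ R S : ℝ → ℝ, JKML.AdmissibleRadii κ x y R S →
          (∀ t : ℝ, 0 < t → MeasureTheory.Integrable (fun p : ℝ × ℝ =>
            JKML.jkmlIntegrand α β κ γ₁ γ₂ x y (R t) (S t) t p.1 p.2)) ∧
          MeasureTheory.IntegrableOn (fun t : ℝ => ∫ σ : ℝ, ∫ τ : ℝ,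
            JKML.jkmlIntegrand α β κ γ₁ γ₂ x y (R t) (S t) t σ τ) (Set.Ioi 0) ∧
          JKML.jkml α β κ γ₁ γ₂ x y =
            -1 / (4 * (Real.pi : ℂ) ^ 2 * Complex.Gamma γ₂) *
              ∫ t in Set.Ioi (0 : ℝ), ∫ σ : ℝ, ∫ τ : ℝ,
                JKML.jkmlIntegrand α β κ γ₁ γ₂ x y (R t) (S t) t σ τ)) ∧
    (∀ (κ n : ℕ) (α β : ℝ) (x y : ℂ), 1 ≤ κ → -1 < α → -1 < β → 0 < 1 + α + β + n →
      ∀ R S : ℝ → ℝ, (∀ t : ℝ, 0 < t → 0 < R t ∧ 0 < S t) →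
        (∀ t : ℝ, 0 < t → MeasureTheory.Integrable (fun p : ℝ × ℝ =>
          JKML.jkPolyIntegrand κ n α β x y (R t) (S t) t p.1 p.2)) ∧
        MeasureTheory.IntegrableOn (fun t : ℝ => ∫ σ : ℝ, ∫ τ : ℝ,
          JKML.jkPolyIntegrand κ n α β x y (R t) (S t) t σ τ) (Set.Ioi 0) ∧
        JKML.jkPoly κ n α β x y =
          -Complex.Gamma (1 + α + n) /
              (4 * (Real.pi : ℂ) ^ 2 * Complex.Gamma (1 + α + β + n) * (n.factorial : ℂ)) *
            ∫ t in Set.Ioi (0 : ℝ), ∫ σ : ℝ, ∫ τ : ℝ,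
              JKML.jkPolyIntegrand κ n α β x y (R t) (S t) t σ τ) := by
  obtain ⟨hjkml, hpoly⟩ := mainTheorem8_general
  refine ⟨fun α β κ γ₁ γ₂ x y hα hβ hκ hγ => ?_, fun κ n α β x y _ hα hβ hγ => ?_⟩
  · obtain ⟨hconv, hadm, hrep⟩ := hjkml α β κ γ₁ γ₂ x y hα hβ hκ hγ
    exact ⟨hconv, hadm, fun hs => hrep hs.summable_tsum⟩
  · exact hpoly κ n α β x y (by simpa using hα) (by simpa using hβ) (by simpa using hγ)
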